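/- For $r\in\mathbb{R}$ let $T_r=e^{ir\partial_x^2}$ be the free Schr\"odinger evolution on $L^2(\mathbb{R})$ (complex-valued functions), i.e. the unitary operator $\widehat{T_rf}(\eta)=e^{-ir\eta^2}\widehat f(\eta)$, where $\widehat f(\eta)=(2\pi)^{-1/2}\int_{\mathbb{R}}e^{-ix\eta}f(x)\,dx$ extended to $L^2(\mathbb{R})$. Let $$\mathcal{Q}(f_1,f_2,f_3,f_4)=\int_0^1\int_{\mathbb{R}}\overline{T_rf_1(x)}\,T_rf_2(x)\,\overline{T_rf_3(x)}\,T_rf_4(x)\,dx\,dr ,\qquad f_j\in L^2(\mathbb{R}).$$ For $\omega>0$, a weak solution of the dispersion management equation with zero residual dispersion, $$\omega f=Q(f,f,f),\qquad Q(f,f,f)=\int_0^1T_r^{-1}\bigl[|T_rf|^2\,T_rf\bigr]\,dr ,$$ is a function $f\in L^2(\mathbb{R})$ such that $\omega\langle g,f\rangle=\mathcal{Q}(g,f,f,f)$ for all $g\in L^2(\mathbb{R})$, where $\langle g,f\rangle=\int_{\mathbb{R}}\overline{g(x)}f(x)\,dx$. **Theorem.** Let $\omega>0$. Every weak solution $f\in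 L^2(\mathbb{R})$ of $\omega f=Q(f,f,f)$ is (after modification on a null set) a Schwartz function. That is, $f$ is infinitely often differentiable and $$\sup_{x\in\mathbb{R}}|x|^m\,|f^{(n)}(x)|<\infty\qquad\text{for all integers } m,n\ge 0 .$$ -/

import Mathlib

open MeasureTheory FourierTransform
open scoped SchwartzMap ComplexConjugate

noncomputable section

/-- The complex Hilbert space `L²(ℝ)`. -/
abbrev L2 : Type := Lp ℂ 2 (volume : Measure ℝ)

/-- The Fourier multiplier of `e^{ir∂²}`. With Mathlib's normalization
`𝓕 f ξ = ∫ e^{-2πixξ} f x dx`, the operator `∂²` is multiplication by `-(2πξ)²` on the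
Fourier side. -/
def schrodingerSymbol (r ξ : ℝ) : ℂ :=
  Complex.exp (-(Complex.I * (r * (2 * Real.pi * ξ) ^ 2 : ℝ)))

theorem memLp_schrodingerSymbol_mul (r : ℝ) (g : L2) :
    MemLp (fun ξ : ℝ => schrodingerSymbol r ξ * g ξ) 2 volume := by
  refine (Lp.memLp g).of_le ?_ (Filter.Eventually.of_forall fun ξ => ?_)
  · refine Continuous.aestronglyMeasurable ?_ |>.mul (Lp.aestronglyMeasurable g)
    unfold schrodingerSymbol
    fun_prop
  · have h : -(Complex.I * (r * (2 * Real.pi * ξ) ^ 2 : ℝ)) =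
        ((-(r * (2 * Real.pi * ξ) ^ 2) : ℝ) : ℂ) * Complex.I := by
      push_cast
      ring
    rw [norm_mul, schrodingerSymbol, h, Complex.norm_exp_ofReal_mul_I, one_mul]

/-- The free Schrödinger evolution `T_r = e^{ir∂²}` on `L²(ℝ)`: take the (Plancherel) Fourier
transform, multiply by the symbol, and transform back. -/
def freeEvolution (r : ℝ) (f : L2) : L2 :=
  𝓕⁻ ((memLp_schrodingerSymbol_mul r (𝓕 f)).toLp
    (fun ξ : ℝ => schrodingerSymbol r ξ * (𝓕 f : L2) ξ))

/-- The four-linear functional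
`𝒬(f₁,f₂,f₃,f₄) = ∫₀¹ ∫_ℝ conj (T_r f₁) · T_r f₂ · conj (T_r f₃) · T_r f₄ dx dr`.
By the Strichartz inequality the inner integral converges absolutely for almost every `r`, and
so does the outer one. -/
def dispersionFunctional (f₁ f₂ f₃ f₄ : L2) : ℂ :=
  ∫ r in (0 : ℝ)..1, ∫ x : ℝ,
    conj (freeEvolution r f₁ x) * freeEvolution r f₂ x *
      conj (freeEvolution r f₃ x) * freeEvolution r f₄ x

/-- `f ∈ L²(ℝ)` is a weak solution of `ω f = Q(f,f,f)`, where
`Q(f,f,f) = ∫₀¹ T_r⁻¹ [|T_r f|² T_r f] dr`: one has `ω ⟨g, f⟩ = 𝒬(g,f,f,f)` for all `g ∈ L²(ℝ)`.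
The inner product is `⟨g, f⟩ = ∫ conj (g x) * f x dx`. -/
def IsWeakSolution (ω : ℝ) (f : L2) : Prop :=
  ∀ g : L2, (ω : ℂ) * inner ℂ g f = dispersionFunctional g f f f

end

/-! The functional is dominated, in position and in frequency alike, by one positive four-linear
form, and that form makes the tails of a solution collapse from scale to scale.

By Plancherel the space integral at time r pairs the Fourier transforms of two products of
evolutions. Each is, up to a phase depending only on the frequency shift a, an ambiguity function of
the data sampled along a line of slope proportional to r (`fourier_conj_freeEvolution_mul`).
Integrating in r before taking absolute values leaves an oscillatory kernel evaluated at s = a(ξ -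
η). Ambiguity functions are covariant under the Fourier transform (`ambiguity_fourier`), so the same
holds in position, with slope -1/(2r) and measure dr/(4πr); the extra 1/r costs only a logarithm at
small s. Both kernels are at most 6 min(|s|^(-1/2), |s|^(-3/4)).

This is dominated by a kernel homogeneous of degree -1, whose form is bounded on L²: for a fixed
ratio t = (ξ - η)/a, Cauchy-Schwarz gives the factor |1 - t|^(-1/2) |1 + t|^(-1/2), and the
remaining integral in t converges (`resonantForm_homogeneousKernel_le`, `resonantConst_lt_top`).
There is room to spare: a factor t^(-1/2) is gained where |a| + |ξ - η| ≥ t.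

Test the equation against the part of f, or of its transform, beyond 3t. Since ξ = (ξ + a) + η - (η
+ a), another of the four points lies beyond t. If only one does, the kernel gains; if two do, there
is an extra tail factor (`decayForm_outer_le`). Hence the tail beyond 3t is o(1) times the tail
beyond t (`eventually_lnorm_outer_le`), so all moments are finite. Finite moments on both sides give
a Schwartz function (`exists_schwartz_ae_eq`). -/

noncomputable section

open scoped ENNReal

/-! ### Phases, translations and modulations under the Fourier transform -/

/-- The unimodular number `e^{it}`. -/
def phase (t : ℝ) : ℂ := Complex.exp (t * Complex.I)

theorem norm_phase (t : ℝ) : ‖phase t‖ = 1 := Complex.norm_exp_ofReal_mul_I t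

theorem phase_add (s t : ℝ) : phase (s + t) = phase s * phase t := by
  simp only [phase, ← Complex.exp_add]
  push_cast
  ring_nf

theorem phase_zero : phase 0 = 1 := by simp [phase]

theorem conj_phase (t : ℝ) : conj (phase t) = phase (-t) := by
  simp [phase, ← Complex.exp_conj]

theorem phase_mul_neg (t : ℝ) : phase t * phase (-t) = 1 := by
  rw [← phase_add, add_neg_cancel, phase_zero]

theorem continuous_phase : Continuous phase := by
  unfold phase
  fun_prop

theorem fourier_eq_integral_phase (f : ℝ → ℂ) (w : ℝ) :
    𝓕 f w = ∫ v : ℝ, phase (-2 * Real.pi * v * w) * f v := by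
  rw [Real.fourier_real_eq_integral_exp_smul]
  rfl

theorem iteratedDeriv_cexp_const_mul_ofReal (n : ℕ) (c : ℂ) :
    iteratedDeriv n (fun x : ℝ => Complex.exp (c * x)) = fun x : ℝ => c ^ n * Complex.exp (c * x) := by
  induction n with
  | zero => simp
  | succ n ih =>
    rw [iteratedDeriv_succ, ih]
    ext x
    have h1 : HasDerivAt (fun x : ℝ => c * (x : ℂ)) c x := by
      simpa using (Complex.ofRealCLM.hasDerivAt (x := x)).const_mul c
    rw [(h1.cexp.const_mul (c ^ n)).deriv]
    ring

theorem hasTemperateGrowth_phase (a : ℝ) :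
    Function.HasTemperateGrowth (fun x : ℝ => phase (a * x)) := by
  have h : (fun x : ℝ => phase (a * x)) = fun x : ℝ => Complex.exp (a * Complex.I * x) := by
    ext x
    simp only [phase]
    push_cast
    ring_nf
  refine ⟨?_, fun n => ⟨0, |a| ^ n, fun x => ?_⟩⟩
  · rw [h]
    exact (contDiff_const.mul Complex.ofRealCLM.contDiff).cexp
  · rw [norm_iteratedFDeriv_eq_norm_iteratedDeriv, h, iteratedDeriv_cexp_const_mul_ofReal,
      norm_mul, ← congrFun h x, norm_phase]
    simp

/-- Translation of Schwartz functions. -/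
def schwartzTranslate (h : ℝ) (φ : 𝓢(ℝ, ℂ)) : 𝓢(ℝ, ℂ) :=
  SchwartzMap.compCLMOfAntilipschitz ℂ (K := 1) (g := fun x : ℝ => x + h) (by fun_prop)
    (IsometryEquiv.addRight h).isometry.antilipschitz φ

theorem schwartzTranslate_apply (h : ℝ) (φ : 𝓢(ℝ, ℂ)) (x : ℝ) :
    schwartzTranslate h φ x = φ (x + h) := rfl

/-- Modulation of Schwartz functions. -/
def schwartzModulate (a : ℝ) (φ : 𝓢(ℝ, ℂ)) : 𝓢(ℝ, ℂ) :=
  SchwartzMap.smulLeftCLM ℂ (fun x : ℝ => phase (a * x)) φ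

theorem schwartzModulate_apply (a : ℝ) (φ : 𝓢(ℝ, ℂ)) (x : ℝ) :
    schwartzModulate a φ x = phase (a * x) * φ x :=
  SchwartzMap.smulLeftCLM_apply_apply (hasTemperateGrowth_phase a) φ x

theorem fourier_schwartzTranslate (h : ℝ) (φ : 𝓢(ℝ, ℂ)) (x : ℝ) :
    𝓕 (schwartzTranslate h φ) x = phase (2 * Real.pi * h * x) * 𝓕 φ x := by
  rw [SchwartzMap.fourier_coe, SchwartzMap.fourier_coe, fourier_eq_integral_phase,
    fourier_eq_integral_phase, ← integral_sub_right_eq_self _ h, ← integral_const_mul]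
  congr 1 with v
  rw [schwartzTranslate_apply, sub_add_cancel, ← mul_assoc, ← phase_add]
  ring_nf

theorem fourier_schwartzModulate (a : ℝ) (φ : 𝓢(ℝ, ℂ)) (x : ℝ) :
    𝓕 (schwartzModulate (2 * Real.pi * a) φ) x = 𝓕 φ (x - a) := by
  rw [SchwartzMap.fourier_coe, SchwartzMap.fourier_coe, fourier_eq_integral_phase,
    fourier_eq_integral_phase]
  congr 1 with v
  rw [schwartzModulate_apply, ← mul_assoc, ← phase_add]
  ring_nf

/-- The multiplication formula between Schwartz functions and `L²` functions. -/
theorem integral_fourier_mul_eq (φ : 𝓢(ℝ, ℂ)) (F : L2) :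
    ∫ x, 𝓕 φ x * F x = ∫ x, φ x * (𝓕 F : L2) x := by
  have h := congrArg (fun T => T φ) (Lp.fourier_toTemperedDistribution_eq F)
  simpa [TemperedDistribution.fourier_apply] using h

/-- Locally integrable functions are determined by their pairings with Schwartz functions. -/
theorem ae_eq_of_forall_schwartz {F H : ℝ → ℂ} (hF : LocallyIntegrable F)
    (hH : LocallyIntegrable H) (h : ∀ φ : 𝓢(ℝ, ℂ), ∫ x, φ x * F x = ∫ x, φ x * H x) :
    F =ᵐ[volume] H := by
  refine ae_eq_of_integral_contDiff_smul_eq hF hH fun g hg hc => ?_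
  have h1 : HasCompactSupport (Complex.ofRealCLM ∘ g) := hc.comp_left rfl
  have h2 : ContDiff ℝ (⊤ : ℕ∞) (Complex.ofRealCLM ∘ g) := by fun_prop
  simpa using h (h1.toSchwartzMap h2)

theorem L2.locallyIntegrable (F : L2) : LocallyIntegrable F :=
  (Lp.memLp F).locallyIntegrable (by norm_num)

theorem MemLp.two_comp_add_right {F : ℝ → ℂ} (hF : MemLp F 2) (h : ℝ) :
    MemLp (fun x => F (x + h)) 2 :=
  hF.comp_measurePreserving (measurePreserving_add_right volume h)

theorem MemLp.two_phase_mul {F : ℝ → ℂ} (hF : MemLp F 2) (a : ℝ) :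
    MemLp (fun x => phase (a * x) * F x) 2 := by
  refine hF.of_le ?_ (Filter.Eventually.of_forall fun x => ?_)
  · exact ((continuous_phase.comp (continuous_const.mul continuous_id)).aestronglyMeasurable).mul
      hF.aestronglyMeasurable
  · rw [norm_mul, norm_phase, one_mul]

/-- By duality: the multiplication formula moves the modulation onto a Schwartz test function, where
it becomes a translation. -/
theorem fourier_modulate (a : ℝ) {F G : L2}
    (hG : ∀ᵐ x : ℝ, G x = phase (-(2 * Real.pi * a) * x) * F x) :
    ∀ᵐ ξ : ℝ, (𝓕 G : L2) ξ = (𝓕 F : L2) (ξ + a) := by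
  refine ae_eq_of_forall_schwartz (L2.locallyIntegrable _)
    ((MemLp.two_comp_add_right (Lp.memLp _) a).locallyIntegrable (by norm_num)) fun φ => ?_
  rw [← integral_fourier_mul_eq]
  calc ∫ x, 𝓕 φ x * G x = ∫ x, 𝓕 (schwartzTranslate (-a) φ) x * F x := by
        refine integral_congr_ae ?_
        filter_upwards [hG] with x hx
        rw [hx, fourier_schwartzTranslate]
        ring_nf
    _ = ∫ x, φ (x + -a) * (𝓕 F : L2) x := by
        rw [integral_fourier_mul_eq]
        rfl
    _ = _ := by
        rw [← integral_add_right_eq_self _ a]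
        simp

theorem fourier_translate (h : ℝ) {F G : L2} (hG : ∀ᵐ x : ℝ, G x = F (x - h)) :
    ∀ᵐ ξ : ℝ, (𝓕 G : L2) ξ = phase (-(2 * Real.pi * h) * ξ) * (𝓕 F : L2) ξ := by
  refine ae_eq_of_forall_schwartz (L2.locallyIntegrable _)
    ((MemLp.two_phase_mul (Lp.memLp _) _).locallyIntegrable (by norm_num)) fun φ => ?_
  rw [← integral_fourier_mul_eq]
  calc ∫ x, 𝓕 φ x * G x = ∫ x, 𝓕 φ x * F (x - h) := by
        refine integral_congr_ae ?_
        filter_upwards [hG] with x hx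
        rw [hx]
    _ = ∫ x, 𝓕 φ (x - -h) * F x := by
        rw [← integral_add_right_eq_self _ h]
        simp
    _ = ∫ x, 𝓕 (schwartzModulate (2 * Real.pi * -h) φ) x * F x := by
        simp only [fourier_schwartzModulate]
    _ = _ := by
        rw [integral_fourier_mul_eq]
        congr 1 with x
        rw [schwartzModulate_apply]
        ring_nf

/-! ### Compatibility of the Fourier integral with the L² transform -/

theorem integral_schwartz_fourier_mul_eq (φ : 𝓢(ℝ, ℂ)) {u : ℝ → ℂ} (hu : Integrable u) :
    ∫ x, 𝓕 φ x * u x = ∫ x, φ x * 𝓕 u x := by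
  have hφ : Integrable φ volume := φ.integrable
  rw [SchwartzMap.fourier_coe]
  have h := VectorFourier.integral_fourierIntegral_smul_eq_flip (L := innerₗ ℝ)
    Real.continuous_fourierChar continuous_inner hφ hu
  rwa [flip_innerₗ] at h

/-- An integrable function whose Fourier integral is square integrable is itself square
integrable, and its `L²` Fourier transform is the Fourier integral. -/
theorem exists_L2_of_memLp_fourier {u : ℝ → ℂ} (hu : Integrable u) (hU : MemLp (𝓕 u) 2) :
    ∃ U : L2, U =ᵐ[volume] u ∧ (𝓕 U : L2) =ᵐ[volume] 𝓕 u := by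
  refine ⟨𝓕⁻ (hU.toLp _), ?_, ?_⟩
  · refine ae_eq_of_forall_schwartz (L2.locallyIntegrable _) hu.locallyIntegrable fun φ => ?_
    have h1 := integral_fourier_mul_eq (𝓕⁻ φ) (𝓕⁻ (hU.toLp _))
    rw [FourierTransform.fourier_fourierInv_eq, FourierTransform.fourier_fourierInv_eq] at h1
    rw [h1]
    have h2 := integral_schwartz_fourier_mul_eq (𝓕⁻ φ) hu
    rw [FourierTransform.fourier_fourierInv_eq] at h2
    rw [h2]
    refine integral_congr_ae ?_
    filter_upwards [hU.coeFn_toLp] with x hx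
    rw [hx]
  · rw [FourierTransform.fourier_fourierInv_eq]
    exact hU.coeFn_toLp

theorem L2.inner_eq_integral (F G : L2) : inner ℂ F G = ∫ x, conj (F x) * G x := by
  rw [L2.inner_def]
  simp [RCLike.inner_apply, mul_comm]

/-- Plancherel's identity for integrable functions with square integrable Fourier integrals. -/
theorem integral_conj_mul_eq_fourier {u w : ℝ → ℂ} (hu : Integrable u) (hw : Integrable w)
    (hU : MemLp (𝓕 u) 2) (hW : MemLp (𝓕 w) 2) :
    ∫ x, conj (w x) * u x = ∫ ξ, conj (𝓕 w ξ) * 𝓕 u ξ := by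
  obtain ⟨U, hU1, hU2⟩ := exists_L2_of_memLp_fourier hu hU
  obtain ⟨W, hW1, hW2⟩ := exists_L2_of_memLp_fourier hw hW
  have h := Lp.inner_fourier_eq W U
  rw [L2.inner_eq_integral, L2.inner_eq_integral] at h
  calc ∫ x, conj (w x) * u x = ∫ x, conj (W x) * U x := by
        refine integral_congr_ae ?_
        filter_upwards [hU1, hW1] with x h1 h2
        rw [h1, h2]
    _ = _ := h.symm
    _ = _ := by
        refine integral_congr_ae ?_
        filter_upwards [hU2, hW2] with x h1 h2
        rw [h1, h2]

/-! ### Ambiguity functions and the quartic integral at a fixed time -/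

/-- The cross-ambiguity function of `h₁` and `h₂`. -/
def ambiguity (h₁ h₂ : ℝ → ℂ) (a s : ℝ) : ℂ :=
  ∫ ξ, conj (h₁ ξ) * h₂ (ξ + a) * phase (-(s * ξ))

theorem schrodingerSymbol_eq_phase (r ξ : ℝ) :
    schrodingerSymbol r ξ = phase (-(r * (2 * Real.pi * ξ) ^ 2)) := by
  unfold schrodingerSymbol phase
  push_cast
  ring_nf

theorem fourier_freeEvolution (r : ℝ) (f : L2) :
    ∀ᵐ ξ : ℝ, (𝓕 (freeEvolution r f) : L2) ξ =
      phase (-(r * (2 * Real.pi * ξ) ^ 2)) * (𝓕 f : L2) ξ := by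
  unfold freeEvolution
  rw [FourierTransform.fourier_fourierInv_eq]
  filter_upwards [(memLp_schrodingerSymbol_mul r (𝓕 f)).coeFn_toLp] with ξ hξ
  rw [hξ, schrodingerSymbol_eq_phase]

theorem L2.integrable_conj_mul (F G : L2) : Integrable fun x => conj (F x) * G x := by
  have h := L2.integrable_inner (𝕜 := ℂ) F G
  refine h.congr (Filter.Eventually.of_forall fun x => ?_)
  simp [RCLike.inner_apply, mul_comm]

theorem ae_comp_add_right {p : ℝ → Prop} (h : ∀ᵐ x : ℝ, p x) (a : ℝ) : ∀ᵐ x : ℝ, p (x + a) :=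
  (measurePreserving_add_right volume a).quasiMeasurePreserving.ae h

/-- The Fourier integral of a product of `L²` functions is a correlation. -/
theorem fourier_conj_mul (F G : L2) (ζ : ℝ) :
    𝓕 (fun x => conj (F x) * G x) ζ =
      ∫ ξ, conj ((𝓕 F : L2) ξ) * (𝓕 G : L2) (ξ + ζ) := by
  have hm := MemLp.two_phase_mul (Lp.memLp G) (-(2 * Real.pi * ζ))
  have h1 := Lp.inner_fourier_eq F (hm.toLp _)
  rw [L2.inner_eq_integral, L2.inner_eq_integral] at h1
  rw [fourier_eq_integral_phase]
  calc ∫ v, phase (-2 * Real.pi * v * ζ) * (conj (F v) * G v)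
      = ∫ x, conj (F x) * (hm.toLp _ : L2) x := by
        refine integral_congr_ae ?_
        filter_upwards [hm.coeFn_toLp] with x hx
        rw [hx]
        ring_nf
    _ = _ := h1.symm
    _ = _ := by
        refine integral_congr_ae ?_
        filter_upwards [fourier_modulate ζ hm.coeFn_toLp] with x hx
        rw [hx]

theorem fourier_conj_freeEvolution_mul (r : ℝ) (f₁ f₂ : L2) (ζ : ℝ) :
    𝓕 (fun x => conj (freeEvolution r f₁ x) * freeEvolution r f₂ x) ζ =
      phase (-(4 * Real.pi ^ 2 * r * ζ ^ 2)) *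
        ambiguity (𝓕 f₁ : L2) (𝓕 f₂ : L2) ζ (8 * Real.pi ^ 2 * r * ζ) := by
  rw [fourier_conj_mul, ambiguity, ← integral_const_mul]
  refine integral_congr_ae ?_
  filter_upwards [fourier_freeEvolution r f₁,
    ae_comp_add_right (fourier_freeEvolution r f₂) ζ] with ξ h1 h2
  rw [h1, h2, map_mul, conj_phase]
  -- As (ξ + ζ)² - ξ² = ζ² + 2ξζ, the quadratic phases split into a factor free of ξ and a factor
  -- linear in ξ.
  have h3 : phase (- -(r * (2 * Real.pi * ξ) ^ 2)) * phase (-(r * (2 * Real.pi * (ξ + ζ)) ^ 2)) =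
      phase (-(4 * Real.pi ^ 2 * r * ζ ^ 2)) * phase (-(8 * Real.pi ^ 2 * r * ζ * ξ)) := by
    rw [← phase_add, ← phase_add]
    ring_nf
  linear_combination conj ((𝓕 f₁ : L2) ξ) * (𝓕 f₂ : L2) (ξ + ζ) * h3

/-- The ambiguity function of Fourier transforms is that of the functions, rotated by a right
angle. -/
theorem ambiguity_fourier (f₁ f₂ : L2) (ζ h : ℝ) :
    ambiguity (𝓕 f₁ : L2) (𝓕 f₂ : L2) ζ (2 * Real.pi * h) =
      phase (2 * Real.pi * ζ * h) * ambiguity f₁ f₂ (-h) (2 * Real.pi * ζ) := by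
  have hm := MemLp.two_phase_mul (Lp.memLp f₂) (-(2 * Real.pi * ζ))
  have hn := MemLp.two_comp_add_right (Lp.memLp (hm.toLp _)) (-h)
  have h1 := Lp.inner_fourier_eq f₁ (hn.toLp _)
  rw [L2.inner_eq_integral, L2.inner_eq_integral] at h1
  have h2 := fourier_translate h (F := hm.toLp _) (G := hn.toLp _) hn.coeFn_toLp
  calc ambiguity (𝓕 f₁ : L2) (𝓕 f₂ : L2) ζ (2 * Real.pi * h)
      = ∫ x, conj ((𝓕 f₁ : L2) x) * (𝓕 (hn.toLp _) : L2) x := by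
        refine integral_congr_ae ?_
        filter_upwards [h2, fourier_modulate ζ hm.coeFn_toLp] with ξ h3 h4
        rw [h3, h4]
        ring_nf
    _ = ∫ x, conj (f₁ x) * (hn.toLp _ : L2) x := h1
    _ = _ := by
        rw [ambiguity, ← integral_const_mul]
        refine integral_congr_ae ?_
        filter_upwards [hn.coeFn_toLp, ae_comp_add_right hm.coeFn_toLp (-h)] with x h3 h4
        rw [h3, h4]
        have h5 : phase (-(2 * Real.pi * ζ) * (x + -h)) =
            phase (2 * Real.pi * ζ * h) * phase (-(2 * Real.pi * ζ * x)) := by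
          rw [← phase_add]
          ring_nf
        rw [h5]
        ring

/-- The quartic integral in space, for a fixed time. -/
def quarticIntegral (r : ℝ) (f₁ f₂ f₃ f₄ : L2) : ℂ :=
  ∫ x : ℝ, conj (freeEvolution r f₁ x) * freeEvolution r f₂ x *
    conj (freeEvolution r f₃ x) * freeEvolution r f₄ x

theorem memLp_fourier_conj_freeEvolution_mul {r : ℝ} {f₁ f₂ : L2}
    (h : MemLp (fun ζ => ambiguity (𝓕 f₁ : L2) (𝓕 f₂ : L2) ζ (8 * Real.pi ^ 2 * r * ζ)) 2) :
    MemLp (𝓕 fun x => conj (freeEvolution r f₁ x) * freeEvolution r f₂ x) 2 := by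
  have h1 : (𝓕 fun x => conj (freeEvolution r f₁ x) * freeEvolution r f₂ x) = fun ζ =>
      phase (-(4 * Real.pi ^ 2 * r * ζ ^ 2)) *
        ambiguity (𝓕 f₁ : L2) (𝓕 f₂ : L2) ζ (8 * Real.pi ^ 2 * r * ζ) :=
    funext fun ζ => fourier_conj_freeEvolution_mul r f₁ f₂ ζ
  rw [h1]
  refine h.of_le ?_ (Filter.Eventually.of_forall fun x => ?_)
  · refine Continuous.aestronglyMeasurable ?_ |>.mul h.aestronglyMeasurable
    exact continuous_phase.comp (by fun_prop)
  · rw [norm_mul, norm_phase, one_mul]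

/-- Plancherel for the products of evolutions; their quadratic phases depend on ζ and r alone and
cancel against each other. -/
theorem quarticIntegral_eq_frequency {r : ℝ} {f₁ f₂ f₃ f₄ : L2}
    (h : MemLp (fun ζ => ambiguity (𝓕 f₁ : L2) (𝓕 f₂ : L2) ζ (8 * Real.pi ^ 2 * r * ζ)) 2)
    (h' : MemLp (fun ζ => ambiguity (𝓕 f₄ : L2) (𝓕 f₃ : L2) ζ (8 * Real.pi ^ 2 * r * ζ)) 2) :
    quarticIntegral r f₁ f₂ f₃ f₄ =
      ∫ ζ, ambiguity (𝓕 f₁ : L2) (𝓕 f₂ : L2) ζ (8 * Real.pi ^ 2 * r * ζ) *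
        conj (ambiguity (𝓕 f₄ : L2) (𝓕 f₃ : L2) ζ (8 * Real.pi ^ 2 * r * ζ)) := by
  have h1 := integral_conj_mul_eq_fourier (L2.integrable_conj_mul _ _)
    (L2.integrable_conj_mul _ _) (memLp_fourier_conj_freeEvolution_mul h)
    (memLp_fourier_conj_freeEvolution_mul h')
  calc quarticIntegral r f₁ f₂ f₃ f₄ = _ := by
        rw [quarticIntegral]
        congr 1 with x
        rw [map_mul, Complex.conj_conj]
        ring
    _ = _ := h1
    _ = _ := by
        congr 1 with ζ
        rw [fourier_conj_freeEvolution_mul, fourier_conj_freeEvolution_mul, map_mul, conj_phase]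
        linear_combination ambiguity (𝓕 f₁ : L2) (𝓕 f₂ : L2) ζ (8 * Real.pi ^ 2 * r * ζ) *
          conj (ambiguity (𝓕 f₄ : L2) (𝓕 f₃ : L2) ζ (8 * Real.pi ^ 2 * r * ζ)) *
          phase_mul_neg (-(4 * Real.pi ^ 2 * r * ζ ^ 2))

/-- The rotation by a right angle followed by the substitution a = -4πrζ: the factor 1/(4πr) is its
Jacobian, and 2πζ = -a/(2r) gives the new slope. The phases from the rotation cancel. -/
theorem integral_ambiguity_frequency_eq_position {r : ℝ} (hr : 0 < r) (f₁ f₂ f₃ f₄ : L2) :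
    ∫ ζ, ambiguity (𝓕 f₁ : L2) (𝓕 f₂ : L2) ζ (8 * Real.pi ^ 2 * r * ζ) *
        conj (ambiguity (𝓕 f₄ : L2) (𝓕 f₃ : L2) ζ (8 * Real.pi ^ 2 * r * ζ)) =
      (1 / (4 * Real.pi * r) : ℝ) * ∫ a, ambiguity f₁ f₂ a (-1 / (2 * r) * a) *
        conj (ambiguity f₄ f₃ a (-1 / (2 * r) * a)) := by
  have hπ := Real.pi_pos
  have h := Measure.integral_comp_mul_left (fun a => ambiguity f₁ f₂ a (-1 / (2 * r) * a) *
        conj (ambiguity f₄ f₃ a (-1 / (2 * r) * a))) (-(4 * Real.pi * r))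
  have h2 : |(-(4 * Real.pi * r))⁻¹| = 1 / (4 * Real.pi * r) := by
    rw [inv_neg, abs_neg, abs_of_pos (by positivity), one_div]
  rw [h2, Complex.real_smul] at h
  rw [← h]
  congr 1 with ζ
  have h3 : 8 * Real.pi ^ 2 * r * ζ = 2 * Real.pi * (4 * Real.pi * r * ζ) := by ring
  have h4 : -1 / (2 * r) * (-(4 * Real.pi * r) * ζ) = 2 * Real.pi * ζ := by
    field_simp
    ring
  have h5 : -(4 * Real.pi * r) * ζ = -(4 * Real.pi * r * ζ) := by ring
  rw [h3, ambiguity_fourier, ambiguity_fourier, h4, h5, map_mul, conj_phase]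
  linear_combination ambiguity f₁ f₂ (-(4 * Real.pi * r * ζ)) (2 * Real.pi * ζ) *
    conj (ambiguity f₄ f₃ (-(4 * Real.pi * r * ζ)) (2 * Real.pi * ζ)) *
    phase_mul_neg (2 * Real.pi * ζ * (4 * Real.pi * r * ζ))

/-! ### Averaging in time: domination by positive forms -/

/-- The positive four-linear form with kernel `κ`. -/
def resonantForm (κ : ℝ → ℝ → ℝ≥0∞) (g₁ g₂ g₃ g₄ : ℝ → ℝ≥0∞) : ℝ≥0∞ :=
  ∫⁻ a, ∫⁻ ξ, ∫⁻ η, κ a (ξ - η) * (g₁ ξ * g₂ (ξ + a) * (g₃ η * g₄ (η + a)))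

/-- The oscillatory kernel obtained by averaging in time. -/
def oscillatoryKernel (ν : Measure ℝ) (c : ℝ → ℝ) (s : ℝ) : ℂ := ∫ r, phase (-(c r * s)) ∂ν

section

variable {h₁ h₂ h₃ h₄ : ℝ → ℂ}

theorem integrable_conj_mul_comp_add_right (l₁ : MemLp h₁ 2) (l₂ : MemLp h₂ 2) (a : ℝ) :
    Integrable fun ξ => conj (h₁ ξ) * h₂ (ξ + a) :=
  l₁.star.integrable_mul (MemLp.two_comp_add_right l₂ a)

theorem ambiguity_mul_conj_eq_integral_prod (a s : ℝ) :
    ambiguity h₁ h₂ a s * conj (ambiguity h₃ h₄ a s) =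
      ∫ p : ℝ × ℝ, (conj (h₁ p.1) * h₂ (p.1 + a)) * conj (conj (h₃ p.2) * h₄ (p.2 + a)) *
        phase (-(s * (p.1 - p.2))) := by
  unfold ambiguity
  rw [← integral_conj, ← integral_prod_mul, ← Measure.volume_eq_prod]
  congr 1 with p
  simp only [map_mul, conj_phase]
  rw [show -(s * (p.1 - p.2)) = -(s * p.1) + - -(s * p.2) by ring, phase_add]
  ring

theorem measurable_phase_kernel {c : ℝ → ℝ} (hc : Measurable c) (a : ℝ) :
    Measurable fun q : ℝ × (ℝ × ℝ) => phase (-(c q.1 * a * (q.2.1 - q.2.2))) :=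
  continuous_phase.measurable.comp (by fun_prop)

/-- Only the oscillation in r is exploited. For fixed a the integral over ξ and η converges
absolutely and ν is finite, so Fubini puts the r-integral inside before absolute values are taken.
-/
theorem enorm_integral_ambiguity_mul_conj_le (ν : Measure ℝ) [IsFiniteMeasure ν] {c : ℝ → ℝ}
    (hc : Measurable c) (l₁ : MemLp h₁ 2) (l₂ : MemLp h₂ 2) (l₃ : MemLp h₃ 2)
    (l₄ : MemLp h₄ 2) (a : ℝ) :
    ‖∫ r, ambiguity h₁ h₂ a (c r * a) * conj (ambiguity h₃ h₄ a (c r * a)) ∂ν‖ₑ ≤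
      ∫⁻ ξ, ∫⁻ η, ‖oscillatoryKernel ν c (a * (ξ - η))‖ₑ *
        (‖h₁ ξ‖ₑ * ‖h₂ (ξ + a)‖ₑ * (‖h₃ η‖ₑ * ‖h₄ (η + a)‖ₑ)) := by
  set Φ : ℝ × ℝ → ℂ := fun p =>
    (conj (h₁ p.1) * h₂ (p.1 + a)) * conj (conj (h₃ p.2) * h₄ (p.2 + a)) with hΦ
  have hi : Integrable Φ := by
    have i₃ : Integrable fun ξ => conj (conj (h₃ ξ) * h₄ (ξ + a)) :=
      memLp_one_iff_integrable.1
        (memLp_one_iff_integrable.2 (integrable_conj_mul_comp_add_right l₃ l₄ a)).star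
    exact (integrable_conj_mul_comp_add_right l₁ l₂ a).mul_prod i₃
  have hprod : Integrable (Function.uncurry fun (r : ℝ) (p : ℝ × ℝ) =>
      Φ p * phase (-(c r * a * (p.1 - p.2)))) (ν.prod volume) := by
    have h1 : Integrable (fun q : ℝ × (ℝ × ℝ) => Φ q.2) (ν.prod volume) := hi.comp_snd ν
    refine h1.mono ?_ (Filter.Eventually.of_forall fun q => ?_)
    · exact h1.aestronglyMeasurable.mul (measurable_phase_kernel hc a).aestronglyMeasurable
    · simp [Function.uncurry, norm_phase]
  have heq : ∫ r, ambiguity h₁ h₂ a (c r * a) * conj (ambiguity h₃ h₄ a (c r * a)) ∂ν =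
      ∫ p, Φ p * oscillatoryKernel ν c (a * (p.1 - p.2)) := by
    simp_rw [ambiguity_mul_conj_eq_integral_prod]
    rw [integral_integral_swap hprod]
    congr 1 with p
    rw [integral_const_mul, oscillatoryKernel]
    simp only [mul_assoc]
  rw [heq]
  refine (enorm_integral_le_lintegral_enorm _).trans ?_
  rw [Measure.volume_eq_prod]
  refine (lintegral_prod_le _).trans (le_of_eq ?_)
  refine lintegral_congr fun ξ => lintegral_congr fun η => ?_
  simp only [hΦ, enorm_mul, RCLike.enorm_conj]
  ring

theorem stronglyMeasurable_ambiguity (m₁ : Measurable h₁) (m₂ : Measurable h₂) {c : ℝ → ℝ}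
    (hc : Measurable c) :
    StronglyMeasurable fun q : ℝ × ℝ => ambiguity h₁ h₂ q.2 (c q.1 * q.2) := by
  refine StronglyMeasurable.integral_prod_right (f := fun (q : ℝ × ℝ) (ξ : ℝ) =>
    conj (h₁ ξ) * h₂ (ξ + q.2) * phase (-(c q.1 * q.2 * ξ))) ?_
  refine Measurable.stronglyMeasurable ?_
  refine Measurable.mul (Measurable.mul ?_ ?_) ?_
  · exact Complex.continuous_conj.measurable.comp (m₁.comp measurable_snd)
  · exact m₂.comp (by fun_prop)
  · exact continuous_phase.measurable.comp (by fun_prop)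

theorem norm_ambiguity_le (a s : ℝ) :
    ‖ambiguity h₁ h₂ a s‖ ≤ ∫ ξ, ‖conj (h₁ ξ) * h₂ (ξ + a)‖ := by
  refine (norm_integral_le_integral_norm _).trans (le_of_eq ?_)
  simp [norm_phase]

/-- This is the space-time (Strichartz) bound. With equal pairs the product is a square, so Tonelli
needs no prior integrability in (r, a). -/
theorem lintegral_enorm_ambiguity_sq_le (ν : Measure ℝ) [IsFiniteMeasure ν] {c : ℝ → ℝ}
    (hc : Measurable c) (m₁ : Measurable h₁) (m₂ : Measurable h₂) (l₁ : MemLp h₁ 2)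
    (l₂ : MemLp h₂ 2) :
    ∫⁻ q, ‖ambiguity h₁ h₂ q.2 (c q.1 * q.2)‖ₑ ^ 2 ∂(ν.prod volume) ≤
      resonantForm (fun a b => ‖oscillatoryKernel ν c (a * b)‖ₑ)
        (fun ξ => ‖h₁ ξ‖ₑ) (fun ξ => ‖h₂ ξ‖ₑ) (fun ξ => ‖h₁ ξ‖ₑ) (fun ξ => ‖h₂ ξ‖ₑ) := by
  have hm := stronglyMeasurable_ambiguity m₁ m₂ hc
  rw [lintegral_prod_symm _ (hm.enorm.pow_const 2).aemeasurable]
  refine lintegral_mono fun a => ?_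
  refine le_trans (le_of_eq ?_) (enorm_integral_ambiguity_mul_conj_le ν hc l₁ l₂ l₁ l₂ a)
  have hma : StronglyMeasurable fun r => ambiguity h₁ h₂ a (c r * a) :=
    hm.comp_measurable (g := fun r : ℝ => (r, a)) (by fun_prop)
  have h1 : (fun r => ambiguity h₁ h₂ a (c r * a) * conj (ambiguity h₁ h₂ a (c r * a))) =
      fun r => ((‖ambiguity h₁ h₂ a (c r * a)‖ ^ 2 : ℝ) : ℂ) := by
    ext r
    rw [Complex.mul_conj, Complex.normSq_eq_norm_sq]
  have hi : Integrable (fun r => ‖ambiguity h₁ h₂ a (c r * a)‖ ^ 2) ν := by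
    refine Integrable.of_bound (hma.norm.pow 2).aestronglyMeasurable
      ((∫ ξ, ‖conj (h₁ ξ) * h₂ (ξ + a)‖) ^ 2) (Filter.Eventually.of_forall fun r => ?_)
    rw [Real.norm_of_nonneg (by positivity)]
    exact pow_le_pow_left₀ (norm_nonneg _) (norm_ambiguity_le _ _) 2
  rw [h1, integral_complex_ofReal, ← ofReal_norm, Complex.norm_real, Real.norm_of_nonneg
    (integral_nonneg fun r => by positivity), ofReal_integral_eq_lintegral_ofReal hi
    (Filter.Eventually.of_forall fun r => by positivity)]
  refine lintegral_congr fun r => ?_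
  rw [ENNReal.ofReal_pow (norm_nonneg _), ofReal_norm]

theorem memLp_two_ambiguity (ν : Measure ℝ) [IsFiniteMeasure ν] {c : ℝ → ℝ}
    (hc : Measurable c) (m₁ : Measurable h₁) (m₂ : Measurable h₂) (l₁ : MemLp h₁ 2)
    (l₂ : MemLp h₂ 2)
    (hfin : resonantForm (fun a b => ‖oscillatoryKernel ν c (a * b)‖ₑ)
        (fun ξ => ‖h₁ ξ‖ₑ) (fun ξ => ‖h₂ ξ‖ₑ) (fun ξ => ‖h₁ ξ‖ₑ) (fun ξ => ‖h₂ ξ‖ₑ) ≠ ∞) :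
    MemLp (fun q : ℝ × ℝ => ambiguity h₁ h₂ q.2 (c q.1 * q.2)) 2 (ν.prod volume) := by
  refine ⟨(stronglyMeasurable_ambiguity m₁ m₂ hc).aestronglyMeasurable, ?_⟩
  rw [eLpNorm_lt_top_iff_lintegral_rpow_enorm_lt_top (by norm_num) (by norm_num)]
  simp only [ENNReal.toReal_ofNat, ENNReal.rpow_ofNat]
  exact (lintegral_enorm_ambiguity_sq_le ν hc m₁ m₂ l₁ l₂).trans_lt hfin.lt_top

theorem ae_memLp_two_ambiguity {ν : Measure ℝ} [SFinite ν] {c : ℝ → ℝ}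
    (h : MemLp (fun q : ℝ × ℝ => ambiguity h₁ h₂ q.2 (c q.1 * q.2)) 2 (ν.prod volume)) :
    ∀ᵐ r ∂ν, MemLp (fun a => ambiguity h₁ h₂ a (c r * a)) 2 := by
  have h2 := h.integrable_norm_pow (by norm_num)
  filter_upwards [h.aestronglyMeasurable.prodMk_left, h2.prod_right_ae] with r hr hr2
  rw [← memLp_norm_iff hr, memLp_two_iff_integrable_sq hr.norm]
  exact hr2

/-- Square integrability in (r, a) of both factors is what allows the r- and a-integrals to be
exchanged. -/
theorem enorm_integral_integral_ambiguity_le (ν : Measure ℝ) [IsFiniteMeasure ν] {c : ℝ → ℝ}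
    (hc : Measurable c) (l₁ : MemLp h₁ 2) (l₂ : MemLp h₂ 2) (l₃ : MemLp h₃ 2) (l₄ : MemLp h₄ 2)
    (h : MemLp (fun q : ℝ × ℝ => ambiguity h₁ h₂ q.2 (c q.1 * q.2)) 2 (ν.prod volume))
    (h' : MemLp (fun q : ℝ × ℝ => ambiguity h₃ h₄ q.2 (c q.1 * q.2)) 2 (ν.prod volume)) :
    ‖∫ r, (∫ a, ambiguity h₁ h₂ a (c r * a) * conj (ambiguity h₃ h₄ a (c r * a))) ∂ν‖ₑ ≤
      resonantForm (fun a b => ‖oscillatoryKernel ν c (a * b)‖ₑ)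
        (fun ξ => ‖h₁ ξ‖ₑ) (fun ξ => ‖h₂ ξ‖ₑ) (fun ξ => ‖h₃ ξ‖ₑ) (fun ξ => ‖h₄ ξ‖ₑ) := by
  have hi : Integrable (Function.uncurry fun r a =>
      ambiguity h₁ h₂ a (c r * a) * conj (ambiguity h₃ h₄ a (c r * a))) (ν.prod volume) :=
    h.integrable_mul h'.star
  rw [integral_integral_swap hi]
  refine (enorm_integral_le_lintegral_enorm _).trans (lintegral_mono fun a => ?_)
  exact enorm_integral_ambiguity_mul_conj_le ν hc l₁ l₂ l₃ l₄ a

end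

/-! ### Boundedness on L² of the form with a homogeneous kernel -/

/-- A homogeneous kernel of degree `-1` dominating `|ab|^{-1/2}`, with a gain away from the
origin. -/
def homogeneousKernel (a b : ℝ) : ℝ :=
  (|a| + |b|) ^ (1 / 2 : ℝ) * |a| ^ (-3 / 4 : ℝ) * |b| ^ (-3 / 4 : ℝ)

theorem homogeneousKernel_nonneg (a b : ℝ) : 0 ≤ homogeneousKernel a b := by
  unfold homogeneousKernel
  positivity

theorem measurable_homogeneousKernel : Measurable fun q : ℝ × ℝ => homogeneousKernel q.1 q.2 := by
  unfold homogeneousKernel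
  fun_prop

/-- The exponents add up to 1/2 - 3/4 - 3/4 = -1, which the Jacobian |a| of η = ξ - at compensates;
after this substitution the kernel depends on t alone. -/
theorem homogeneousKernel_mul {a : ℝ} (ha : a ≠ 0) (t : ℝ) :
    |a| * homogeneousKernel a (a * t) = homogeneousKernel 1 t := by
  have h : 0 < |a| := abs_pos.2 ha
  unfold homogeneousKernel
  rw [abs_mul, abs_one, Real.one_rpow, Real.mul_rpow h.le (abs_nonneg t),
    show |a| + |a| * |t| = |a| * (1 + |t|) by ring, Real.mul_rpow h.le (by positivity)]
  have h2 : |a| * (|a| ^ (1 / 2 : ℝ) * |a| ^ (-3 / 4 : ℝ) * |a| ^ (-3 / 4 : ℝ)) = 1 := by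
    nth_rewrite 1 [← Real.rpow_one |a|]
    rw [← Real.rpow_add h, ← Real.rpow_add h, ← Real.rpow_add h]
    norm_num
  linear_combination (1 + |t|) ^ (1 / 2 : ℝ) * |t| ^ (-3 / 4 : ℝ) * h2

/-- The `L²` norm of a nonnegative function. -/
def lnorm (g : ℝ → ℝ≥0∞) : ℝ≥0∞ := (∫⁻ x, g x ^ 2) ^ (1 / 2 : ℝ)

theorem lintegral_comp_add_mul {f : ℝ → ℝ≥0∞} (hf : Measurable f) (d : ℝ) {c : ℝ} (hc : c ≠ 0) :
    ∫⁻ x, f (d + c * x) = ENNReal.ofReal |c⁻¹| * ∫⁻ x, f x := by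
  have h1 : ∫⁻ x, f (d + c * x) = ∫⁻ y, f (d + y) ∂(Measure.map (c * ·) volume) := by
    rw [lintegral_map (by fun_prop) (by fun_prop)]
  rw [h1, Real.map_volume_mul_left hc, lintegral_smul_measure, lintegral_add_left_eq_self,
    smul_eq_mul]

theorem lintegral_comp_sub_eq {f : ℝ → ℝ≥0∞} (hf : Measurable f) (d : ℝ) :
    ∫⁻ x, f (d - x) = ∫⁻ x, f x := by
  have h := lintegral_comp_add_mul hf d (c := -1) (by norm_num)
  simpa [sub_eq_add_neg] using h

theorem lintegral_correlation_sq {g g' : ℝ → ℝ≥0∞} (hg : Measurable g) (hg' : Measurable g')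
    {c : ℝ} (hc : c ≠ 0) :
    ∫⁻ a, ∫⁻ ξ, (g ξ * g' (ξ + c * a)) ^ 2 =
      ENNReal.ofReal |c⁻¹| * ((∫⁻ x, g x ^ 2) * ∫⁻ x, g' x ^ 2) := by
  rw [lintegral_lintegral_swap (by fun_prop)]
  have h : ∀ ξ, ∫⁻ a, (g ξ * g' (ξ + c * a)) ^ 2 =
      g ξ ^ 2 * (ENNReal.ofReal |c⁻¹| * ∫⁻ x, g' x ^ 2) := by
    intro ξ
    simp_rw [mul_pow]
    rw [lintegral_const_mul _ (by fun_prop),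
      lintegral_comp_add_mul (f := fun x => g' x ^ 2) (by fun_prop) ξ hc]
  simp_rw [h]
  rw [lintegral_mul_const _ (by fun_prop)]
  ring

/-- Cauchy-Schwarz in (a, ξ) after regrouping: the arguments of g₁ and g₄ differ by (1 - t)a, those
of g₂ and g₃ by -(1 + t)a, so each squared pair factorizes by Fubini. -/
theorem lintegral_quadruple_le {g₁ g₂ g₃ g₄ : ℝ → ℝ≥0∞} (m₁ : Measurable g₁) (m₂ : Measurable g₂)
    (m₃ : Measurable g₃) (m₄ : Measurable g₄) {t : ℝ} (ht : 1 - t ≠ 0) (ht' : 1 + t ≠ 0) :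
    ∫⁻ a, ∫⁻ ξ, (g₁ ξ * g₂ (ξ + a) * (g₃ (ξ - a * t) * g₄ (ξ - a * t + a))) ≤
      ENNReal.ofReal (|1 - t| ^ (-1 / 2 : ℝ) * |1 + t| ^ (-1 / 2 : ℝ)) *
        (lnorm g₁ * lnorm g₂ * (lnorm g₃ * lnorm g₄)) := by
  have e1 : ∫⁻ a, ∫⁻ ξ, (g₁ ξ * g₄ (ξ - a * t + a)) ^ 2 =
      ENNReal.ofReal |(1 - t)⁻¹| * ((∫⁻ x, g₁ x ^ 2) * ∫⁻ x, g₄ x ^ 2) := by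
    rw [← lintegral_correlation_sq m₁ m₄ ht]
    refine lintegral_congr fun a => lintegral_congr fun ξ => ?_
    rw [show ξ - a * t + a = ξ + (1 - t) * a by ring]
  have e2 : ∫⁻ a, ∫⁻ ξ, (g₂ (ξ + a) * g₃ (ξ - a * t)) ^ 2 =
      ENNReal.ofReal |(-(1 + t))⁻¹| * ((∫⁻ x, g₂ x ^ 2) * ∫⁻ x, g₃ x ^ 2) := by
    rw [← lintegral_correlation_sq m₂ m₃ (neg_ne_zero.2 ht')]
    refine lintegral_congr fun a => ?_
    rw [← lintegral_add_right_eq_self (fun ξ => (g₂ ξ * g₃ (ξ + -(1 + t) * a)) ^ 2) a]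
    refine lintegral_congr fun ξ => ?_
    rw [show ξ - a * t = ξ + a + -(1 + t) * a by ring]
  have e3 : ∀ s : ℝ, s ≠ 0 → ENNReal.ofReal |s⁻¹| ^ (1 / 2 : ℝ) =
      ENNReal.ofReal (|s| ^ (-1 / 2 : ℝ)) := by
    intro s hs
    rw [ENNReal.ofReal_rpow_of_pos (by positivity), abs_inv, ← Real.rpow_neg_one,
      ← Real.rpow_mul (abs_nonneg s)]
    norm_num
  have M1 : Measurable fun q : ℝ × ℝ => g₁ q.2 * g₄ (q.2 - q.1 * t + q.1) := by fun_prop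
  have M2 : Measurable fun q : ℝ × ℝ => g₂ (q.2 + q.1) * g₃ (q.2 - q.1 * t) := by fun_prop
  have hCS := ENNReal.lintegral_mul_le_Lp_mul_Lq ((volume : Measure ℝ).prod volume)
    Real.HolderConjugate.two_two M1.aemeasurable M2.aemeasurable
  simp only [ENNReal.rpow_ofNat, Pi.mul_apply] at hCS
  rw [lintegral_prod _ (by fun_prop), lintegral_prod _ (by fun_prop),
    lintegral_prod _ (by fun_prop)] at hCS
  simp only [e1, e2] at hCS
  calc _ = ∫⁻ a, ∫⁻ ξ, g₁ ξ * g₄ (ξ - a * t + a) * (g₂ (ξ + a) * g₃ (ξ - a * t)) := by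
        refine lintegral_congr fun a => lintegral_congr fun ξ => ?_
        ring
    _ ≤ _ := hCS
    _ = _ := by
        rw [ENNReal.mul_rpow_of_nonneg _ _ (by norm_num), ENNReal.mul_rpow_of_nonneg _ _ (by norm_num),
          ENNReal.mul_rpow_of_nonneg _ _ (by norm_num), ENNReal.mul_rpow_of_nonneg _ _ (by norm_num),
          e3 _ ht, e3 _ (neg_ne_zero.2 ht'), abs_neg, ENNReal.ofReal_mul (by positivity)]
        unfold lnorm
        ring

/-- The norm of the four-linear form with the homogeneous kernel. -/
def resonantConst : ℝ≥0∞ :=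
  ∫⁻ t : ℝ, ENNReal.ofReal
    (homogeneousKernel 1 t * (|1 - t| ^ (-1 / 2 : ℝ) * |1 + t| ^ (-1 / 2 : ℝ)))

theorem resonantForm_homogeneousKernel_le {g₁ g₂ g₃ g₄ : ℝ → ℝ≥0∞} (m₁ : Measurable g₁)
    (m₂ : Measurable g₂) (m₃ : Measurable g₃) (m₄ : Measurable g₄) :
    resonantForm (fun a b => ENNReal.ofReal (homogeneousKernel a b)) g₁ g₂ g₃ g₄ ≤
      resonantConst * (lnorm g₁ * lnorm g₂ * (lnorm g₃ * lnorm g₄)) := by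
  have hk := measurable_homogeneousKernel
  have hk1 : Measurable (homogeneousKernel 1) :=
    hk.comp (g := fun q : ℝ × ℝ => homogeneousKernel q.1 q.2) (f := fun t : ℝ => (1, t))
      (by fun_prop)
  have step : ∀ a : ℝ, a ≠ 0 → ∀ ξ, ∫⁻ η, ENNReal.ofReal (homogeneousKernel a (ξ - η)) *
        (g₁ ξ * g₂ (ξ + a) * (g₃ η * g₄ (η + a))) =
      ∫⁻ t, ENNReal.ofReal (homogeneousKernel 1 t) *
        (g₁ ξ * g₂ (ξ + a) * (g₃ (ξ - a * t) * g₄ (ξ - a * t + a))) := by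
    intro a ha ξ
    have hka : Measurable (homogeneousKernel a) :=
      hk.comp (g := fun q : ℝ × ℝ => homogeneousKernel q.1 q.2) (f := fun t : ℝ => (a, t))
        (by fun_prop)
    set f : ℝ → ℝ≥0∞ := fun b => ENNReal.ofReal (homogeneousKernel a b) *
        (g₁ ξ * g₂ (ξ + a) * (g₃ (ξ - b) * g₄ (ξ - b + a))) with hf
    have hfm : Measurable f := by fun_prop
    have h1 : ∫⁻ η, ENNReal.ofReal (homogeneousKernel a (ξ - η)) *
        (g₁ ξ * g₂ (ξ + a) * (g₃ η * g₄ (η + a))) = ∫⁻ b, f b := by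
      rw [← lintegral_comp_sub_eq hfm ξ]
      simp [hf]
    have h2 := lintegral_comp_add_mul hfm 0 ha
    have h3 : ∫⁻ b, f b = ENNReal.ofReal |a| * ∫⁻ t, f (0 + a * t) := by
      rw [h2, ← mul_assoc, ← ENNReal.ofReal_mul (abs_nonneg a), ← abs_mul, mul_inv_cancel₀ ha]
      simp
    rw [h1, h3, ← lintegral_const_mul _ (by fun_prop)]
    refine lintegral_congr fun t => ?_
    rw [zero_add, hf, ← homogeneousKernel_mul ha t, ENNReal.ofReal_mul (abs_nonneg a), mul_assoc]
  have hne : ∀ c : ℝ, ∀ᵐ a : ℝ, a ≠ c := fun c => Measure.ae_ne volume c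
  calc resonantForm (fun a b => ENNReal.ofReal (homogeneousKernel a b)) g₁ g₂ g₃ g₄
      = ∫⁻ a, ∫⁻ ξ, ∫⁻ t, ENNReal.ofReal (homogeneousKernel 1 t) *
        (g₁ ξ * g₂ (ξ + a) * (g₃ (ξ - a * t) * g₄ (ξ - a * t + a))) := by
        refine lintegral_congr_ae ?_
        filter_upwards [hne 0] with a ha
        exact lintegral_congr fun ξ => step a ha ξ
    _ = ∫⁻ a, ∫⁻ t, ∫⁻ ξ, ENNReal.ofReal (homogeneousKernel 1 t) *
        (g₁ ξ * g₂ (ξ + a) * (g₃ (ξ - a * t) * g₄ (ξ - a * t + a))) := by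
        refine lintegral_congr fun a => ?_
        rw [lintegral_lintegral_swap (by fun_prop)]
    _ = ∫⁻ t, ∫⁻ a, ∫⁻ ξ, ENNReal.ofReal (homogeneousKernel 1 t) *
        (g₁ ξ * g₂ (ξ + a) * (g₃ (ξ - a * t) * g₄ (ξ - a * t + a))) := by
        rw [lintegral_lintegral_swap]
        refine (Measurable.lintegral_prod_right' (f := fun q : (ℝ × ℝ) × ℝ =>
          ENNReal.ofReal (homogeneousKernel 1 q.1.2) * (g₁ q.2 * g₂ (q.2 + q.1.1) *
          (g₃ (q.2 - q.1.1 * q.1.2) * g₄ (q.2 - q.1.1 * q.1.2 + q.1.1)))) ?_).aemeasurable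
        fun_prop
    _ ≤ ∫⁻ t, ENNReal.ofReal (homogeneousKernel 1 t) *
        (ENNReal.ofReal (|1 - t| ^ (-1 / 2 : ℝ) * |1 + t| ^ (-1 / 2 : ℝ)) *
        (lnorm g₁ * lnorm g₂ * (lnorm g₃ * lnorm g₄))) := by
        refine lintegral_mono_ae ?_
        filter_upwards [hne 1, hne (-1)] with t h1 h2
        have h3 := lintegral_quadruple_le m₁ m₂ m₃ m₄ (sub_ne_zero.2 h1.symm)
          (fun h => h2 (by linarith))
        refine le_trans (le_of_eq ?_) (mul_le_mul_right h3 _)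
        rw [← lintegral_const_mul _ (Measurable.lintegral_prod_right' (f := fun q : ℝ × ℝ =>
          (g₁ q.2 * g₂ (q.2 + q.1) * (g₃ (q.2 - q.1 * t) * g₄ (q.2 - q.1 * t + q.1))))
          (by fun_prop))]
        refine lintegral_congr fun a => ?_
        rw [lintegral_const_mul _ (by fun_prop)]
    _ = _ := by
        rw [resonantConst, ← lintegral_mul_const _ (by fun_prop)]
        refine lintegral_congr fun t => ?_
        rw [ENNReal.ofReal_mul (homogeneousKernel_nonneg 1 t)]
        ring

theorem lintegral_abs_rpow_lt_top {p : ℝ} (hp : -1 < p) (R : ℝ) (c : ℝ) :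
    ∫⁻ t in Set.Icc (-R) R, ENNReal.ofReal (|t + c| ^ p) < ∞ := by
  have h0 : ∀ S : ℝ, 0 ≤ S → IntegrableOn (fun t : ℝ => |t| ^ p) (Set.Icc (-S) S) := by
    intro S hS
    have hpos : IntegrableOn (fun t : ℝ => |t| ^ p) (Set.Ioc 0 S) := by
      have h := (intervalIntegral.intervalIntegrable_rpow' (a := 0) (b := S) hp).1
      exact h.congr_fun (fun t ht => by simp only [abs_of_pos ht.1]) measurableSet_Ioc
    have hneg : IntegrableOn (fun t : ℝ => |t| ^ p) (Set.Ico (-S) 0) := by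
      have h := hpos.comp_neg
      simpa using h
    have h0 : IntegrableOn (fun t : ℝ => |t| ^ p) {0} :=
      integrableOn_singleton (hx := by simp)
    refine ((hneg.union h0).union hpos).mono_set fun t ht => ?_
    rcases lt_trichotomy t 0 with h | h | h
    · exact Or.inl (Or.inl ⟨ht.1, h⟩)
    · exact Or.inl (Or.inr h)
    · exact Or.inr ⟨h, ht.2⟩
  have h1 := (h0 (|R| + |c|) (by positivity)).lintegral_lt_top
  refine lt_of_le_of_lt ?_ h1
  rw [← lintegral_indicator measurableSet_Icc, ← lintegral_indicator measurableSet_Icc,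
    ← lintegral_add_right_eq_self ((Set.Icc (-(|R| + |c|)) (|R| + |c|)).indicator _) c]
  refine lintegral_mono fun t => ?_
  by_cases ht : t ∈ Set.Icc (-R) R
  · have ht2 : t + c ∈ Set.Icc (-(|R| + |c|)) (|R| + |c|) := by
      rw [Set.mem_Icc, ← abs_le]
      refine (abs_add_le _ _).trans (add_le_add ?_ le_rfl)
      exact (abs_le.2 ht).trans (le_abs_self R)
    rw [Set.indicator_of_mem ht, Set.indicator_of_mem ht2]
  · rw [Set.indicator_of_notMem ht]
    exact zero_le

/-- For |t| ≤ 2, at most one of the singular points 0, 1, -1 is within 1/2; the other two powers and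
the square root are at most 2, whence 8 = 2·2·2. For |t| > 2, all three bases are at least (1 +
|t|)/3, the exponents sum to 1/2 - 7/4 = -5/4, and 3^(7/4) ≤ 9. -/
theorem resonantConst_integrand_le (t : ℝ) :
    homogeneousKernel 1 t * (|1 - t| ^ (-1 / 2 : ℝ) * |1 + t| ^ (-1 / 2 : ℝ)) ≤
      (Set.Icc (-2 : ℝ) 2).indicator (fun t => 8 * (|t| ^ (-3 / 4 : ℝ) + |t + -1| ^ (-1 / 2 : ℝ) +
        |t + 1| ^ (-1 / 2 : ℝ))) t + 9 * (1 + ‖t‖) ^ (-(5 / 4) : ℝ) := by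
  rw [Real.norm_eq_abs]
  unfold homogeneousKernel
  rw [abs_one, Real.one_rpow, mul_one]
  have hA := abs_nonneg t
  have hle : ∀ {x y p : ℝ}, 0 < x → x ≤ y → p ≤ 0 → y ^ p ≤ x ^ p := fun hx hxy hp =>
    Real.rpow_le_rpow_of_nonpos hx hxy hp
  have hhalf : ∀ {x p : ℝ}, 1 / 2 ≤ x → -1 ≤ p → p ≤ 0 → x ^ p ≤ 2 := by
    intro x p hx hp hp'
    calc x ^ p ≤ (1 / 2 : ℝ) ^ p := hle (by norm_num) hx hp'
      _ ≤ (1 / 2 : ℝ) ^ (-1 : ℝ) :=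
        Real.rpow_le_rpow_of_exponent_ge (by norm_num) (by norm_num) hp
      _ = 2 := by rw [Real.rpow_neg_one]; norm_num
  have habs1 : 1 - |t| ≤ |1 - t| := by
    have := abs_sub_abs_le_abs_sub 1 t
    rwa [abs_one] at this
  have habs2 : 1 - |t| ≤ |1 + t| := by
    have := abs_sub_abs_le_abs_sub 1 (-t)
    rwa [abs_one, abs_neg, sub_neg_eq_add] at this
  have habs3 : |t| - 1 ≤ |1 - t| := by
    have := abs_sub_abs_le_abs_sub t 1
    rwa [abs_one, abs_sub_comm t 1] at this
  have habs4 : |t| - 1 ≤ |1 + t| := by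
    have := abs_sub_abs_le_abs_sub t (-1)
    rwa [abs_neg, abs_one, sub_neg_eq_add, add_comm t 1] at this
  have hsqrt : |t| ≤ 2 → (1 + |t|) ^ (1 / 2 : ℝ) ≤ 2 := by
    intro h
    rw [← Real.sqrt_eq_rpow, Real.sqrt_le_left (by norm_num)]
    linarith
  set X := |t| ^ (-3 / 4 : ℝ) with hX
  set Y := |1 - t| ^ (-1 / 2 : ℝ) with hY
  set Z := |1 + t| ^ (-1 / 2 : ℝ) with hZ
  have hX0 : 0 ≤ X := by positivity
  have hY0 : 0 ≤ Y := by positivity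
  have hZ0 : 0 ≤ Z := by positivity
  have hS0 : 0 ≤ (1 + |t|) ^ (1 / 2 : ℝ) := by positivity
  have hT0 : 0 ≤ 9 * (1 + |t|) ^ (-(5 / 4) : ℝ) := by positivity
  by_cases ht : |t| ≤ 2
  · rw [Set.indicator_of_mem (Set.mem_Icc.2 (abs_le.1 ht))]
    have hs := hsqrt ht
    refine le_add_of_le_of_nonneg ?_ hT0
    rw [show t + -1 = -(1 - t) by ring, abs_neg, add_comm t 1, ← hX, ← hY, ← hZ]
    by_cases ht2 : |t| ≤ 1 / 2
    · have hy : Y ≤ 2 := hhalf (by linarith) (by norm_num) (by norm_num)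
      have hz : Z ≤ 2 := hhalf (by linarith) (by norm_num) (by norm_num)
      calc (1 + |t|) ^ (1 / 2 : ℝ) * X * (Y * Z) ≤ 2 * X * (2 * 2) := by gcongr
        _ ≤ _ := by linarith
    · have hx : X ≤ 2 := hhalf (by linarith) (by norm_num) (by norm_num)
      rcases le_total 0 t with h | h
      · have hz : Z ≤ 2 := hhalf (by rw [abs_of_nonneg (by linarith)]; linarith)
          (by norm_num) (by norm_num)
        calc (1 + |t|) ^ (1 / 2 : ℝ) * X * (Y * Z) ≤ 2 * 2 * (Y * 2) := by gcongr
          _ ≤ _ := by linarith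
      · have hy : Y ≤ 2 := hhalf (by rw [abs_of_nonneg (by linarith)]; linarith)
          (by norm_num) (by norm_num)
        calc (1 + |t|) ^ (1 / 2 : ℝ) * X * (Y * Z) ≤ 2 * 2 * (2 * Z) := by gcongr
          _ ≤ _ := by linarith
  · rw [Set.indicator_of_notMem (s := Set.Icc (-2 : ℝ) 2) (fun h => ht (abs_le.2 h)), zero_add]
    have hw : 0 < 1 + |t| := by positivity
    have hw3 : 0 < (1 + |t|) / 3 := by positivity
    set w := 1 + |t| with hwdef
    have hx : X ≤ (w / 3) ^ (-3 / 4 : ℝ) := hle hw3 (by linarith) (by norm_num)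
    have hy : Y ≤ (w / 3) ^ (-1 / 2 : ℝ) := hle hw3 (by linarith) (by norm_num)
    have hz : Z ≤ (w / 3) ^ (-1 / 2 : ℝ) := hle hw3 (by linarith) (by norm_num)
    calc w ^ (1 / 2 : ℝ) * X * (Y * Z)
        ≤ w ^ (1 / 2 : ℝ) * (w / 3) ^ (-3 / 4 : ℝ) *
          ((w / 3) ^ (-1 / 2 : ℝ) * (w / 3) ^ (-1 / 2 : ℝ)) := by gcongr
      _ = w ^ (1 / 2 : ℝ) * (w / 3) ^ (-(7 / 4) : ℝ) := by
        rw [mul_assoc, ← Real.rpow_add hw3, ← Real.rpow_add hw3]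
        norm_num
      _ = w ^ (1 / 2 : ℝ) * w ^ (-(7 / 4) : ℝ) * 3 ^ (7 / 4 : ℝ) := by
        rw [Real.div_rpow hw.le (by norm_num), Real.rpow_neg (by norm_num : (0 : ℝ) ≤ 3),
          div_inv_eq_mul, mul_assoc]
      _ = 3 ^ (7 / 4 : ℝ) * w ^ (-(5 / 4) : ℝ) := by
        rw [← Real.rpow_add hw, mul_comm]
        norm_num
      _ ≤ 3 ^ (2 : ℝ) * w ^ (-(5 / 4) : ℝ) := by
        gcongr
        · norm_num
        · norm_num
      _ = _ := by norm_num

theorem resonantConst_lt_top : resonantConst < ∞ := by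
  have hB : ∫⁻ t : ℝ, ENNReal.ofReal ((1 + ‖t‖) ^ (-(5 / 4) : ℝ)) < ∞ :=
    (integrable_one_add_norm (by norm_num)).lintegral_lt_top
  have h1 := lintegral_abs_rpow_lt_top (p := -3 / 4) (by norm_num) 2 0
  have h2 := lintegral_abs_rpow_lt_top (p := -1 / 2) (by norm_num) 2 (-1)
  have h3 := lintegral_abs_rpow_lt_top (p := -1 / 2) (by norm_num) 2 1
  simp only [add_zero] at h1
  have hi : Measurable fun t : ℝ => ENNReal.ofReal (8 * (|t| ^ (-3 / 4 : ℝ) +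
      |t + -1| ^ (-1 / 2 : ℝ) + |t + 1| ^ (-1 / 2 : ℝ))) := by fun_prop
  calc resonantConst ≤ ∫⁻ t : ℝ, ((Set.Icc (-2 : ℝ) 2).indicator (fun t => ENNReal.ofReal
        (8 * (|t| ^ (-3 / 4 : ℝ) + |t + -1| ^ (-1 / 2 : ℝ) + |t + 1| ^ (-1 / 2 : ℝ)))) t +
        ENNReal.ofReal (9 * (1 + ‖t‖) ^ (-(5 / 4) : ℝ))) := by
        refine lintegral_mono fun t => ?_
        refine (ENNReal.ofReal_le_ofReal (resonantConst_integrand_le t)).trans ?_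
        refine ENNReal.ofReal_add_le.trans (add_le_add (le_of_eq ?_) le_rfl)
        by_cases ht : t ∈ Set.Icc (-2 : ℝ) 2
        · rw [Set.indicator_of_mem ht, Set.indicator_of_mem ht]
        · rw [Set.indicator_of_notMem ht, Set.indicator_of_notMem ht, ENNReal.ofReal_zero]
    _ = (∫⁻ t in Set.Icc (-2 : ℝ) 2, ENNReal.ofReal
        (8 * (|t| ^ (-3 / 4 : ℝ) + |t + -1| ^ (-1 / 2 : ℝ) + |t + 1| ^ (-1 / 2 : ℝ)))) +
        ∫⁻ t : ℝ, ENNReal.ofReal (9 * (1 + ‖t‖) ^ (-(5 / 4) : ℝ)) := by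
        rw [lintegral_add_left (hi.indicator measurableSet_Icc),
          lintegral_indicator measurableSet_Icc]
    _ < ∞ := by
        refine ENNReal.add_lt_top.2 ⟨?_, ?_⟩
        · have h4 : ∀ t : ℝ, ENNReal.ofReal (8 * (|t| ^ (-3 / 4 : ℝ) + |t + -1| ^ (-1 / 2 : ℝ) +
              |t + 1| ^ (-1 / 2 : ℝ))) = ENNReal.ofReal 8 * (ENNReal.ofReal (|t| ^ (-3 / 4 : ℝ)) +
              ENNReal.ofReal (|t + -1| ^ (-1 / 2 : ℝ)) +
              ENNReal.ofReal (|t + 1| ^ (-1 / 2 : ℝ))) := by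
            intro t
            rw [ENNReal.ofReal_mul (by norm_num), ENNReal.ofReal_add (by positivity) (by positivity),
              ENNReal.ofReal_add (by positivity) (by positivity)]
          simp_rw [h4]
          rw [lintegral_const_mul _ (by fun_prop), lintegral_add_left (by fun_prop),
            lintegral_add_left (by fun_prop)]
          exact ENNReal.mul_lt_top ENNReal.ofReal_lt_top
            (ENNReal.add_lt_top.2 ⟨ENNReal.add_lt_top.2 ⟨h1, h2⟩, h3⟩)
        · simp_rw [ENNReal.ofReal_mul (by norm_num : (0 : ℝ) ≤ 9)]
          rw [lintegral_const_mul _ (by fun_prop)]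
          exact ENNReal.mul_lt_top ENNReal.ofReal_lt_top hB

/-! ### Decay of the oscillatory kernels -/

/-- The decay common to the oscillatory kernels on the frequency side and on the position side. -/
def decayKernel (s : ℝ) : ℝ := min (|s| ^ (-1 / 2 : ℝ)) (|s| ^ (-3 / 4 : ℝ))

theorem measurable_decayKernel : Measurable decayKernel := by
  unfold decayKernel
  fun_prop

/-- The constant is 6 = 4 + 2: for small |s| the logarithm is at most 2|s|^(-1/2) and the constant 4
is at most 4|s|^(-1/2). For large |s|, 1/|s| is below both powers. -/
theorem le_decayKernel_of_le {s y : ℝ} (hs : s ≠ 0) (h : 1 ≤ |s| → y ≤ 4 / |s|)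
    (h' : |s| ≤ 1 → y ≤ 4 + Real.log |s|⁻¹) : y ≤ 6 * decayKernel s := by
  have hx : 0 < |s| := abs_pos.2 hs
  unfold decayKernel
  set x := |s|
  rcases le_total 1 x with h1 | h1
  · have key : ∀ p : ℝ, -1 ≤ p → y ≤ 6 * x ^ p := by
      intro p hp
      have h2 : x⁻¹ ≤ x ^ p := by
        rw [← Real.rpow_neg_one]
        exact Real.rpow_le_rpow_of_exponent_le h1 hp
      have h3 := h h1
      rw [div_eq_mul_inv] at h3
      have : 0 ≤ x ^ p := by positivity
      linarith
    rw [mul_min_of_nonneg _ _ (by norm_num)]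
    exact le_min (key _ (by norm_num)) (key _ (by norm_num))
  · have h2 : (1 : ℝ) ≤ x ^ (-1 / 2 : ℝ) :=
      Real.one_le_rpow_of_pos_of_le_one_of_nonpos hx h1 (by norm_num)
    have h3 : x ^ (-1 / 2 : ℝ) ≤ x ^ (-3 / 4 : ℝ) :=
      Real.rpow_le_rpow_of_exponent_ge hx h1 (by norm_num)
    have h4 : Real.log x⁻¹ ≤ x⁻¹ ^ (1 / 2 : ℝ) / (1 / 2) :=
      Real.log_le_rpow_div (by positivity) (by norm_num)
    have h5 : x⁻¹ ^ (1 / 2 : ℝ) = x ^ (-1 / 2 : ℝ) := by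
      rw [← Real.rpow_neg_one, ← Real.rpow_mul hx.le]
      norm_num
    have h6 := h' h1
    rw [h5] at h4
    rw [min_eq_left h3]
    linarith

theorem hasDerivAt_phase_comp {g : ℝ → ℝ} {g' r : ℝ} (hg : HasDerivAt g g' r) :
    HasDerivAt (fun r => phase (g r)) (g' * Complex.I * phase (g r)) r := by
  unfold phase
  have h := (hg.ofReal_comp.mul_const Complex.I).cexp
  rw [mul_comm]
  exact h

theorem norm_integral_phase_mul_le {b : ℝ} (hb : b ≠ 0) :
    ‖∫ r in (0 : ℝ)..1, phase (-(b * r))‖ ≤ 2 / |b| := by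
  have hd : ∀ r ∈ Set.uIcc (0 : ℝ) 1, HasDerivAt (fun r => (Complex.I / b) * phase (-(b * r)))
      (phase (-(b * r))) r := by
    intro r _
    have h1 : HasDerivAt (fun r : ℝ => -(b * r)) (-b) r := by
      convert! (hasDerivAt_id' r).const_mul (-b) using 1
      · ext x
        ring
      · ring
    have h2 := (hasDerivAt_phase_comp h1).const_mul (Complex.I / b)
    convert! h2 using 1
    have : (b : ℂ) ≠ 0 := by exact_mod_cast hb
    field_simp
    push_cast
    linear_combination b * phase (-(b * r)) * Complex.I_sq
  rw [intervalIntegral.integral_eq_sub_of_hasDerivAt hd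
    ((continuous_phase.comp (by fun_prop)).intervalIntegrable _ _), ← mul_sub, norm_mul, norm_div,
    Complex.norm_I, Complex.norm_real, Real.norm_eq_abs]
  have h3 : ‖phase (-(b * 1)) - phase (-(b * 0))‖ ≤ 2 := by
    refine (norm_sub_le _ _).trans ?_
    rw [norm_phase, norm_phase]
    norm_num
  calc 1 / |b| * _ ≤ 1 / |b| * 2 := by gcongr
    _ = _ := by ring

theorem norm_frequencyKernel_le {s : ℝ} (hs : s ≠ 0) :
    ‖oscillatoryKernel (volume.restrict (Set.Ioc 0 1)) (fun r => 8 * Real.pi ^ 2 * r) s‖ ≤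
      6 * decayKernel s := by
  have hx : 0 < |s| := abs_pos.2 hs
  have heq : oscillatoryKernel (volume.restrict (Set.Ioc 0 1)) (fun r => 8 * Real.pi ^ 2 * r) s =
      ∫ r in (0 : ℝ)..1, phase (-(8 * Real.pi ^ 2 * s * r)) := by
    rw [intervalIntegral.integral_of_le zero_le_one]
    unfold oscillatoryKernel
    congr 1 with r
    ring_nf
  rw [heq]
  refine le_decayKernel_of_le hs (fun _ => ?_) (fun h => ?_)
  · refine (norm_integral_phase_mul_le (by have := Real.pi_pos; positivity)).trans ?_
    have h1 : 1 ≤ 8 * Real.pi ^ 2 := by nlinarith [Real.pi_gt_three]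
    rw [abs_mul, abs_of_pos (by linarith)]
    gcongr
    · norm_num
    · nlinarith
  · have h1 := intervalIntegral.norm_integral_le_of_norm_le_const (a := 0) (b := 1) (C := 1)
      (f := fun r => phase (-(8 * Real.pi ^ 2 * s * r))) (fun r _ => (norm_phase _).le)
    have h2 : 0 ≤ Real.log |s|⁻¹ := Real.log_nonneg ((one_le_inv₀ hx).2 h)
    norm_num at h1
    linarith

/-- The measure `dr / (4πr)` on `(ε, 1]`. -/
def positionMeasure (ε : ℝ) : Measure ℝ :=
  (volume.restrict (Set.Ioc ε 1)).withDensity fun r => (Real.toNNReal (1 / (4 * Real.pi * r)) : ℝ≥0∞)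

theorem isFiniteMeasure_positionMeasure {ε : ℝ} (hε : 0 < ε) :
    IsFiniteMeasure (positionMeasure ε) := by
  refine isFiniteMeasure_withDensity (ne_of_lt ?_)
  have hπ := Real.pi_pos
  calc ∫⁻ r in Set.Ioc ε 1, (Real.toNNReal (1 / (4 * Real.pi * r)) : ℝ≥0∞)
      ≤ ∫⁻ _ in Set.Ioc ε 1, (Real.toNNReal (1 / (4 * Real.pi * ε)) : ℝ≥0∞) := by
        refine setLIntegral_mono measurable_const fun r hr => ?_
        have := hr.1
        gcongr
    _ < ∞ := by
        rw [setLIntegral_const]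
        exact ENNReal.mul_lt_top ENNReal.coe_lt_top (by simp)

theorem integral_positionMeasure {ε : ℝ} (hε : 0 < ε) (g : ℝ → ℂ) :
    ∫ r, g r ∂(positionMeasure ε) = ∫ r in Set.Ioc ε 1, ((1 / (4 * Real.pi * r) : ℝ) : ℂ) * g r := by
  unfold positionMeasure
  rw [integral_withDensity_eq_integral_smul (by fun_prop)]
  refine setIntegral_congr_fun measurableSet_Ioc fun r hr => ?_
  have hr0 : 0 < r := hε.trans hr.1
  have hπ := Real.pi_pos
  simp only [NNReal.smul_def, Complex.real_smul]
  rw [Real.coe_toNNReal _ (by positivity)]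

/-- Integration by parts with primitive (2i/s) r e^(is/(2r)). The endpoints contribute 2T/|s| and
2ε/|s|, the remainder 2(T - ε)/|s|, so ε drops out of the total. -/
theorem norm_integral_phase_inv_div_le {s ε T : ℝ} (hs : s ≠ 0) (hε : 0 < ε) (hT : ε ≤ T) :
    ‖∫ r in ε..T, ((1 / r : ℝ) : ℂ) * phase (s / (2 * r))‖ ≤ 4 * T / |s| := by
  have hpos : ∀ r ∈ Set.uIcc ε T, 0 < r := fun r hr => by
    rw [Set.uIcc_of_le hT] at hr
    exact hε.trans_le hr.1
  have hd : ∀ r ∈ Set.uIcc ε T, HasDerivAt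
      (fun r : ℝ => (2 * Complex.I / s) * (r * phase (s / (2 * r))))
      ((2 * Complex.I / s) * phase (s / (2 * r)) + ((1 / r : ℝ) : ℂ) * phase (s / (2 * r))) r := by
    intro r hr
    have hr0 := (hpos r hr).ne'
    have h1 : HasDerivAt (fun r : ℝ => s / (2 * r)) (-(s / (2 * r ^ 2))) r := by
      have h2 := ((hasDerivAt_inv hr0).const_mul (s / 2))
      convert! h2 using 1
      · ext x
        ring
      · ring
    have h3 := ((hasDerivAt_id r).ofReal_comp.mul (hasDerivAt_phase_comp h1)).const_mul
      (2 * Complex.I / s)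
    convert! h3 using 1
    have hs' : (s : ℂ) ≠ 0 := by exact_mod_cast hs
    have hr' : (r : ℂ) ≠ 0 := by exact_mod_cast hr0
    simp only [id, Complex.ofReal_one, one_mul]
    push_cast
    field_simp
    linear_combination s * phase (s / (2 * r)) * Complex.I_sq
  have hc : ContinuousOn (fun r : ℝ => phase (s / (2 * r))) (Set.uIcc ε T) := by
    refine continuous_phase.comp_continuousOn ?_
    exact continuousOn_const.div (by fun_prop) fun r hr => by
      have := hpos r hr
      positivity
  have hc2 : ContinuousOn (fun r : ℝ => ((1 / r : ℝ) : ℂ)) (Set.uIcc ε T) := by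
    refine Complex.continuous_ofReal.comp_continuousOn ?_
    exact continuousOn_const.div continuousOn_id fun r hr => (hpos r hr).ne'
  have i1 : IntervalIntegrable (fun r : ℝ => (2 * Complex.I / s) * phase (s / (2 * r))) volume ε T :=
    (continuousOn_const.mul hc).intervalIntegrable
  have i2 : IntervalIntegrable (fun r : ℝ => ((1 / r : ℝ) : ℂ) * phase (s / (2 * r))) volume ε T :=
    (hc2.mul hc).intervalIntegrable
  have hF := intervalIntegral.integral_eq_sub_of_hasDerivAt hd (i1.add i2)
  rw [intervalIntegral.integral_add i1 i2] at hF
  have e : ∫ r in ε..T, ((1 / r : ℝ) : ℂ) * phase (s / (2 * r)) =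
      (2 * Complex.I / s) * (T * phase (s / (2 * T))) -
        (2 * Complex.I / s) * (ε * phase (s / (2 * ε))) -
        ∫ r in ε..T, (2 * Complex.I / s) * phase (s / (2 * r)) := by
    linear_combination hF
  have n0 : ‖(2 * Complex.I / s : ℂ)‖ = 2 / |s| := by simp
  have n1 : ‖∫ r in ε..T, (2 * Complex.I / s) * phase (s / (2 * r))‖ ≤ 2 / |s| * |T - ε| :=
    intervalIntegral.norm_integral_le_of_norm_le_const fun r _ => by
      rw [norm_mul, norm_phase, n0, mul_one]
  rw [abs_of_nonneg (sub_nonneg.2 hT)] at n1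
  rw [e]
  refine (norm_sub_le _ _).trans ?_
  refine (add_le_add (norm_sub_le _ _) n1).trans (le_of_eq ?_)
  simp only [norm_mul, norm_phase, n0, Complex.norm_real, Real.norm_eq_abs, abs_of_pos hε,
    abs_of_pos (hε.trans_le hT), mul_one]
  ring

theorem norm_integral_phase_inv_div_le_log {s ε : ℝ} (hε : 0 < ε) (hε' : ε ≤ 1) :
    ‖∫ r in ε..1, ((1 / r : ℝ) : ℂ) * phase (s / (2 * r))‖ ≤ Real.log ε⁻¹ := by
  have h1 := intervalIntegral.norm_integral_le_integral_norm (f := fun r : ℝ =>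
    ((1 / r : ℝ) : ℂ) * phase (s / (2 * r))) (μ := volume) hε'
  refine h1.trans (le_of_eq ?_)
  rw [show ε⁻¹ = 1 / ε by ring, ← integral_one_div_of_pos hε one_pos]
  refine intervalIntegral.integral_congr fun r hr => ?_
  rw [Set.uIcc_of_le hε'] at hr
  have : 0 < r := hε.trans_le hr.1
  simp only [norm_mul, norm_phase, mul_one, Complex.norm_real, Real.norm_eq_abs]
  rw [abs_of_pos (by positivity)]

theorem norm_integral_phase_inv_div_le_decayKernel {s ε : ℝ} (hs : s ≠ 0) (hε : 0 < ε)
    (hε' : ε ≤ 1) :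
    ‖∫ r in ε..1, ((1 / r : ℝ) : ℂ) * phase (s / (2 * r))‖ ≤ 6 * decayKernel s := by
  have hx : 0 < |s| := abs_pos.2 hs
  refine le_decayKernel_of_le hs (fun _ => ?_) (fun h => ?_)
  · simpa using norm_integral_phase_inv_div_le hs hε hε'
  -- The phase is fast for r < |s| and slow for r > |s|. Splitting there, integration by parts gives
  -- 4 below and the trivial bound gives log(1/|s|) above.
  · rcases le_total |s| ε with h1 | h1
    · refine (norm_integral_phase_inv_div_le_log hε hε').trans ?_
      have : Real.log ε⁻¹ ≤ Real.log |s|⁻¹ := by gcongr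
      linarith
    · have hi : ∀ u v : ℝ, 0 < u → 0 < v → IntervalIntegrable
          (fun r : ℝ => ((1 / r : ℝ) : ℂ) * phase (s / (2 * r))) volume u v := by
        intro u v hu hv
        have hpos : ∀ r ∈ Set.uIcc u v, 0 < r := fun r hr => (lt_min hu hv).trans_le hr.1
        refine ContinuousOn.intervalIntegrable ?_
        refine ContinuousOn.mul (Complex.continuous_ofReal.comp_continuousOn ?_)
          (continuous_phase.comp_continuousOn ?_)
        · exact continuousOn_const.div continuousOn_id fun r hr => (hpos r hr).ne'
        · exact continuousOn_const.div (by fun_prop) fun r hr => by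
            have := hpos r hr
            positivity
      rw [← intervalIntegral.integral_add_adjacent_intervals (hi ε |s| hε hx) (hi |s| 1 hx one_pos)]
      refine (norm_add_le _ _).trans (add_le_add ?_ (norm_integral_phase_inv_div_le_log hx h))
      refine (norm_integral_phase_inv_div_le hs hε h1).trans (le_of_eq ?_)
      field_simp

theorem norm_positionKernel_le {s ε : ℝ} (hs : s ≠ 0) (hε : 0 < ε) (hε' : ε ≤ 1) :
    ‖oscillatoryKernel (positionMeasure ε) (fun r => -1 / (2 * r)) s‖ ≤ 6 * decayKernel s := by
  have heq : oscillatoryKernel (positionMeasure ε) (fun r => -1 / (2 * r)) s =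
      ((1 / (4 * Real.pi) : ℝ) : ℂ) *
        ∫ r in ε..1, ((1 / r : ℝ) : ℂ) * phase (s / (2 * r)) := by
    rw [oscillatoryKernel, integral_positionMeasure hε, intervalIntegral.integral_of_le hε',
      ← integral_const_mul]
    congr 1 with r
    rw [show -(-1 / (2 * r) * s) = s / (2 * r) by ring, ← mul_assoc, ← Complex.ofReal_mul]
    congr 2
    ring
  have hπ := Real.pi_gt_three
  rw [heq, norm_mul, Complex.norm_real, Real.norm_of_nonneg (by positivity)]
  refine le_trans ?_ (norm_integral_phase_inv_div_le_decayKernel hs hε hε')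
  refine mul_le_of_le_one_left (norm_nonneg _) ?_
  rw [div_le_one (by positivity)]
  linarith

/-! ### The dispersion functional bounded in frequency and in position -/

/-- The positive four-linear form with the decay kernel. -/
def decayForm (g₁ g₂ g₃ g₄ : ℝ → ℝ≥0∞) : ℝ≥0∞ :=
  resonantForm (fun a b => ENNReal.ofReal (decayKernel (a * b))) g₁ g₂ g₃ g₄

theorem resonantForm_le_mul {κ κ' : ℝ → ℝ → ℝ≥0∞} {C : ℝ≥0∞} (hC : C ≠ ∞)
    (h : ∀ a b, a ≠ 0 → b ≠ 0 → κ a b ≤ C * κ' a b) (g₁ g₂ g₃ g₄ : ℝ → ℝ≥0∞) :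
    resonantForm κ g₁ g₂ g₃ g₄ ≤ C * resonantForm κ' g₁ g₂ g₃ g₄ := by
  unfold resonantForm
  rw [← lintegral_const_mul' _ _ hC]
  refine lintegral_mono_ae ?_
  filter_upwards [Measure.ae_ne volume 0] with a ha
  rw [← lintegral_const_mul' _ _ hC]
  refine lintegral_mono fun ξ => ?_
  simp only
  rw [← lintegral_const_mul' _ _ hC]
  refine lintegral_mono_ae ?_
  filter_upwards [Measure.ae_ne volume ξ] with η hη
  rw [← mul_assoc C]
  exact mul_le_mul_left (h a _ ha (sub_ne_zero.2 hη.symm)) _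

/-- The quotient of the two sides reduces the claim to (|a||b|)^(1/4) ≤ (|a| + |b|)^(1/2). -/
theorem abs_mul_rpow_le_homogeneousKernel {a b : ℝ} (ha : a ≠ 0) (hb : b ≠ 0) :
    |a * b| ^ (-1 / 2 : ℝ) ≤ homogeneousKernel a b := by
  have ha' := abs_pos.2 ha
  have hb' := abs_pos.2 hb
  have h1 : |a * b| ^ (-1 / 2 : ℝ) =
      (|a| * |b|) ^ (1 / 4 : ℝ) * (|a| ^ (-3 / 4 : ℝ) * |b| ^ (-3 / 4 : ℝ)) := by
    rw [← Real.mul_rpow ha'.le hb'.le, ← Real.rpow_add (by positivity), abs_mul]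
    norm_num
  rw [h1, homogeneousKernel, mul_assoc]
  refine mul_le_mul_of_nonneg_right ?_ (by positivity)
  calc (|a| * |b|) ^ (1 / 4 : ℝ) ≤ ((|a| + |b|) ^ (2 : ℝ)) ^ (1 / 4 : ℝ) := by
        gcongr
        rw [Real.rpow_two]
        nlinarith
    _ = _ := by
        rw [← Real.rpow_mul (by positivity)]
        norm_num

theorem decayForm_le {g₁ g₂ g₃ g₄ : ℝ → ℝ≥0∞} (m₁ : Measurable g₁)
    (m₂ : Measurable g₂) (m₃ : Measurable g₃) (m₄ : Measurable g₄) :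
    decayForm g₁ g₂ g₃ g₄ ≤ resonantConst * (lnorm g₁ * lnorm g₂ * (lnorm g₃ * lnorm g₄)) := by
  refine le_trans ?_ (resonantForm_homogeneousKernel_le m₁ m₂ m₃ m₄)
  refine (resonantForm_le_mul ENNReal.one_ne_top (fun a b ha hb => ?_) _ _ _ _).trans_eq (one_mul _)
  rw [one_mul]
  exact ENNReal.ofReal_le_ofReal
    ((min_le_left _ _).trans (abs_mul_rpow_le_homogeneousKernel ha hb))

theorem lnorm_enorm (F : L2) : lnorm (fun x => ‖F x‖ₑ) = ‖F‖ₑ := by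
  rw [Lp.enorm_def, eLpNorm_eq_lintegral_rpow_enorm_toReal (by norm_num) (by norm_num)]
  simp [lnorm]

theorem L2.measurable (F : L2) : Measurable F := (Lp.stronglyMeasurable F).measurable

theorem decayForm_enorm_ne_top (F₁ F₂ F₃ F₄ : L2) :
    decayForm (fun x => ‖F₁ x‖ₑ) (fun x => ‖F₂ x‖ₑ) (fun x => ‖F₃ x‖ₑ) (fun x => ‖F₄ x‖ₑ) ≠ ∞ := by
  have m := fun F : L2 => (L2.measurable F).enorm
  refine ((decayForm_le (m F₁) (m F₂) (m F₃) (m F₄)).trans_lt ?_).ne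
  simp only [lnorm_enorm]
  have h := fun F : L2 => enorm_lt_top (x := F)
  exact ENNReal.mul_lt_top resonantConst_lt_top (ENNReal.mul_lt_top
    (ENNReal.mul_lt_top (h _) (h _)) (ENNReal.mul_lt_top (h _) (h _)))

theorem resonantForm_oscillatoryKernel_le {ν : Measure ℝ} {c : ℝ → ℝ}
    (hK : ∀ s, s ≠ 0 → ‖oscillatoryKernel ν c s‖ ≤ 6 * decayKernel s) (g₁ g₂ g₃ g₄ : ℝ → ℝ≥0∞) :
    resonantForm (fun a b => ‖oscillatoryKernel ν c (a * b)‖ₑ) g₁ g₂ g₃ g₄ ≤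
      ENNReal.ofReal 6 * decayForm g₁ g₂ g₃ g₄ := by
  refine resonantForm_le_mul ENNReal.ofReal_ne_top (fun a b ha hb => ?_) _ _ _ _
  rw [← ENNReal.ofReal_mul (by norm_num), ← ofReal_norm]
  exact ENNReal.ofReal_le_ofReal (hK _ (mul_ne_zero ha hb))

theorem memLp_two_ambiguity_of_kernel {ν : Measure ℝ} [IsFiniteMeasure ν] {c : ℝ → ℝ}
    (hc : Measurable c) (hK : ∀ s, s ≠ 0 → ‖oscillatoryKernel ν c s‖ ≤ 6 * decayKernel s)
    (F₁ F₂ : L2) :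
    MemLp (fun q : ℝ × ℝ => ambiguity F₁ F₂ q.2 (c q.1 * q.2)) 2 (ν.prod volume) := by
  refine memLp_two_ambiguity ν hc (L2.measurable _) (L2.measurable _) (Lp.memLp _) (Lp.memLp _) ?_
  refine ((resonantForm_oscillatoryKernel_le hK _ _ _ _).trans_lt ?_).ne
  exact ENNReal.mul_lt_top ENNReal.ofReal_lt_top (decayForm_enorm_ne_top _ _ _ _).lt_top

theorem enorm_integral_integral_ambiguity_le_decayForm {ν : Measure ℝ} [IsFiniteMeasure ν]
    {c : ℝ → ℝ} (hc : Measurable c)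
    (hK : ∀ s, s ≠ 0 → ‖oscillatoryKernel ν c s‖ ≤ 6 * decayKernel s) (F₁ F₂ F₃ F₄ : L2) :
    ‖∫ r, (∫ a, ambiguity F₁ F₂ a (c r * a) * conj (ambiguity F₃ F₄ a (c r * a))) ∂ν‖ₑ ≤
      ENNReal.ofReal 6 * decayForm (fun x => ‖F₁ x‖ₑ) (fun x => ‖F₂ x‖ₑ)
        (fun x => ‖F₃ x‖ₑ) (fun x => ‖F₄ x‖ₑ) :=
  (enorm_integral_integral_ambiguity_le ν hc (Lp.memLp _) (Lp.memLp _) (Lp.memLp _) (Lp.memLp _)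
    (memLp_two_ambiguity_of_kernel hc hK _ _) (memLp_two_ambiguity_of_kernel hc hK _ _)).trans
    (resonantForm_oscillatoryKernel_le hK _ _ _ _)

/-- Plancherel at a fixed time needs both ambiguity functions square integrable along the line of
slope 8π²r; the space-time bound supplies this for almost every r. -/
theorem ae_quarticIntegral_eq_frequency (f₁ f₂ f₃ f₄ : L2) :
    ∀ᵐ r ∂(volume.restrict (Set.Ioc (0 : ℝ) 1)), quarticIntegral r f₁ f₂ f₃ f₄ =
      ∫ ζ, ambiguity (𝓕 f₁ : L2) (𝓕 f₂ : L2) ζ (8 * Real.pi ^ 2 * r * ζ) *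
        conj (ambiguity (𝓕 f₄ : L2) (𝓕 f₃ : L2) ζ (8 * Real.pi ^ 2 * r * ζ)) := by
  have hc : Measurable fun r : ℝ => 8 * Real.pi ^ 2 * r := by fun_prop
  filter_upwards [ae_memLp_two_ambiguity
      (memLp_two_ambiguity_of_kernel hc (fun s hs => norm_frequencyKernel_le hs) (𝓕 f₁) (𝓕 f₂)),
    ae_memLp_two_ambiguity
      (memLp_two_ambiguity_of_kernel hc (fun s hs => norm_frequencyKernel_le hs) (𝓕 f₄) (𝓕 f₃))]
    with r h h'
  exact quarticIntegral_eq_frequency h h'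

theorem dispersionFunctional_eq_integral (f₁ f₂ f₃ f₄ : L2) :
    dispersionFunctional f₁ f₂ f₃ f₄ = ∫ r in Set.Ioc (0 : ℝ) 1, quarticIntegral r f₁ f₂ f₃ f₄ := by
  unfold dispersionFunctional
  rw [intervalIntegral.integral_of_le zero_le_one]
  rfl

theorem enorm_dispersionFunctional_le_frequency (f₁ f₂ f₃ f₄ : L2) :
    ‖dispersionFunctional f₁ f₂ f₃ f₄‖ₑ ≤ ENNReal.ofReal 6 *
      decayForm (fun x => ‖(𝓕 f₁ : L2) x‖ₑ) (fun x => ‖(𝓕 f₂ : L2) x‖ₑ)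
        (fun x => ‖(𝓕 f₄ : L2) x‖ₑ) (fun x => ‖(𝓕 f₃ : L2) x‖ₑ) := by
  rw [dispersionFunctional_eq_integral, integral_congr_ae (ae_quarticIntegral_eq_frequency _ _ _ _)]
  exact enorm_integral_integral_ambiguity_le_decayForm (c := fun r : ℝ => 8 * Real.pi ^ 2 * r)
    (by fun_prop) (fun s hs => norm_frequencyKernel_le hs) _ _ _ _

/-- The cutoff ε makes the measure dr/(4πr) finite, as Fubini requires; the bound is uniform in ε,
so the cutoff can be removed by a limit. -/
theorem enorm_setIntegral_quarticIntegral_le {ε : ℝ} (hε : 0 < ε) (hε' : ε ≤ 1)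
    (f₁ f₂ f₃ f₄ : L2) :
    ‖∫ r in Set.Ioc ε 1, quarticIntegral r f₁ f₂ f₃ f₄‖ₑ ≤ ENNReal.ofReal 6 *
      decayForm (fun x => ‖f₁ x‖ₑ) (fun x => ‖f₂ x‖ₑ) (fun x => ‖f₄ x‖ₑ) (fun x => ‖f₃ x‖ₑ) := by
  have := isFiniteMeasure_positionMeasure hε
  have heq : ∫ r in Set.Ioc ε 1, quarticIntegral r f₁ f₂ f₃ f₄ =
      ∫ r, (∫ a, ambiguity f₁ f₂ a (-1 / (2 * r) * a) *
        conj (ambiguity f₄ f₃ a (-1 / (2 * r) * a))) ∂(positionMeasure ε) := by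
    rw [integral_positionMeasure hε]
    refine integral_congr_ae ?_
    have h1 := ae_mono (Measure.restrict_mono (Set.Ioc_subset_Ioc_left hε.le) le_rfl)
      (ae_quarticIntegral_eq_frequency f₁ f₂ f₃ f₄)
    filter_upwards [h1, ae_restrict_mem measurableSet_Ioc] with r hr hr2
    rw [hr, integral_ambiguity_frequency_eq_position (hε.trans hr2.1)]
  rw [heq]
  exact enorm_integral_integral_ambiguity_le_decayForm (c := fun r : ℝ => -1 / (2 * r))
    (by fun_prop) (fun s hs => norm_positionKernel_le hs hε hε') _ _ _ _

theorem enorm_dispersionFunctional_le_position (f₁ f₂ f₃ f₄ : L2) :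
    ‖dispersionFunctional f₁ f₂ f₃ f₄‖ₑ ≤ ENNReal.ofReal 6 *
      decayForm (fun x => ‖f₁ x‖ₑ) (fun x => ‖f₂ x‖ₑ) (fun x => ‖f₄ x‖ₑ) (fun x => ‖f₃ x‖ₑ) := by
  rw [dispersionFunctional_eq_integral]
  by_cases hi : IntegrableOn (fun r => quarticIntegral r f₁ f₂ f₃ f₄) (Set.Ioc (0 : ℝ) 1)
  · have hU : ⋃ n : ℕ, Set.Ioc (1 / ((n : ℝ) + 1)) 1 = Set.Ioc (0 : ℝ) 1 := by
      ext r
      simp only [Set.mem_iUnion, Set.mem_Ioc]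
      constructor
      · rintro ⟨n, h1, h2⟩
        exact ⟨lt_trans (by positivity) h1, h2⟩
      · rintro ⟨h1, h2⟩
        obtain ⟨n, hn⟩ := exists_nat_one_div_lt h1
        exact ⟨n, hn, h2⟩
    have ht := tendsto_setIntegral_of_monotone (μ := volume)
      (s := fun n : ℕ => Set.Ioc (1 / ((n : ℝ) + 1)) 1)
      (f := fun r => quarticIntegral r f₁ f₂ f₃ f₄) (fun n => measurableSet_Ioc)
      (fun m n hmn => Set.Ioc_subset_Ioc_left (by
        have : (m : ℝ) ≤ n := by exact_mod_cast hmn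
        gcongr)) (by rwa [hU])
    rw [hU] at ht
    refine le_of_tendsto' ht.enorm fun n => ?_
    refine enorm_setIntegral_quarticIntegral_le (by positivity) ?_ _ _ _ _
    rw [div_le_one (by positivity)]
    linarith [Nat.cast_nonneg (α := ℝ) n]
  -- A non-integrable function has Bochner integral 0 by convention, so the bound is trivial here.
  · rw [integral_undef hi]
    simp

/-! ### Tail estimates for the positive form -/

/-- The restriction of a function to the complement of the interval `(-s, s)`. -/
def outer (s : ℝ) (g : ℝ → ℝ≥0∞) : ℝ → ℝ≥0∞ := {x : ℝ | s ≤ |x|}.indicator g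

theorem measurableSet_outer (s : ℝ) : MeasurableSet {x : ℝ | s ≤ |x|} :=
  measurableSet_le measurable_const (by fun_prop)

theorem measurable_outer {g : ℝ → ℝ≥0∞} (hg : Measurable g) (s : ℝ) : Measurable (outer s g) :=
  hg.indicator (measurableSet_outer s)

theorem outer_of_le {s x : ℝ} (h : s ≤ |x|) (g : ℝ → ℝ≥0∞) : outer s g x = g x :=
  Set.indicator_of_mem (s := {x : ℝ | s ≤ |x|}) h g

theorem outer_of_lt {s x : ℝ} (h : |x| < s) (g : ℝ → ℝ≥0∞) : outer s g x = 0 :=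
  Set.indicator_of_notMem (s := {x : ℝ | s ≤ |x|}) (not_le.2 h) g

theorem outer_le (s : ℝ) (g : ℝ → ℝ≥0∞) (x : ℝ) : outer s g x ≤ g x :=
  Set.indicator_le_self _ _ _

theorem decayKernel_le_homogeneousKernel (a b : ℝ) :
    decayKernel (a * b) ≤ homogeneousKernel a b := by
  by_cases h : a * b = 0
  -- At s = 0 the real powers with negative exponent take the value 0.
  · refine le_trans (le_of_eq ?_) (homogeneousKernel_nonneg a b)
    rw [h, decayKernel, abs_zero, Real.zero_rpow (by norm_num), Real.zero_rpow (by norm_num),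
      min_self]
  · exact (min_le_left _ _).trans (abs_mul_rpow_le_homogeneousKernel
      (left_ne_zero_of_mul h) (right_ne_zero_of_mul h))

/-- The second branch |ab|^(-3/4) of the minimum equals (|a| + |b|)^(-1/2) times the homogeneous
kernel. -/
theorem decayKernel_le_mul_homogeneousKernel {t : ℝ} (ht : 0 < t) {a b : ℝ}
    (h : t ≤ |a| + |b|) : decayKernel (a * b) ≤ t ^ (-1 / 2 : ℝ) * homogeneousKernel a b := by
  have h1 : |a * b| ^ (-3 / 4 : ℝ) = |a| ^ (-3 / 4 : ℝ) * |b| ^ (-3 / 4 : ℝ) := by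
    rw [abs_mul, Real.mul_rpow (abs_nonneg a) (abs_nonneg b)]
  have h2 : 1 ≤ t ^ (-1 / 2 : ℝ) * (|a| + |b|) ^ (1 / 2 : ℝ) := by
    calc (1 : ℝ) = t ^ (-1 / 2 : ℝ) * t ^ (1 / 2 : ℝ) := by
          rw [← Real.rpow_add ht]
          norm_num
      _ ≤ _ := by gcongr
  calc decayKernel (a * b) ≤ |a * b| ^ (-3 / 4 : ℝ) := min_le_right _ _
    _ = 1 * (|a| ^ (-3 / 4 : ℝ) * |b| ^ (-3 / 4 : ℝ)) := by rw [h1, one_mul]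
    _ ≤ t ^ (-1 / 2 : ℝ) * (|a| + |b|) ^ (1 / 2 : ℝ) *
        (|a| ^ (-3 / 4 : ℝ) * |b| ^ (-3 / 4 : ℝ)) := by gcongr
    _ = _ := by
        unfold homogeneousKernel
        ring

theorem resonantForm_eq_lintegral {κ : ℝ → ℝ → ℝ≥0∞} (hκ : Measurable (Function.uncurry κ))
    {g₁ g₂ g₃ g₄ : ℝ → ℝ≥0∞} (m₁ : Measurable g₁) (m₂ : Measurable g₂) (m₃ : Measurable g₃)
    (m₄ : Measurable g₄) :
    resonantForm κ g₁ g₂ g₃ g₄ = ∫⁻ q : ℝ × (ℝ × ℝ), κ q.1 (q.2.1 - q.2.2) *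
      (g₁ q.2.1 * g₂ (q.2.1 + q.1) * (g₃ q.2.2 * g₄ (q.2.2 + q.1))) := by
  have hm : Measurable fun q : ℝ × (ℝ × ℝ) => κ q.1 (q.2.1 - q.2.2) *
      (g₁ q.2.1 * g₂ (q.2.1 + q.1) * (g₃ q.2.2 * g₄ (q.2.2 + q.1))) := by
    have h1 : Measurable fun q : ℝ × (ℝ × ℝ) => κ q.1 (q.2.1 - q.2.2) :=
      hκ.comp (g := Function.uncurry κ) (f := fun q : ℝ × (ℝ × ℝ) => (q.1, q.2.1 - q.2.2))
        (by fun_prop)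
    fun_prop
  rw [Measure.volume_eq_prod, lintegral_prod _ hm.aemeasurable]
  refine lintegral_congr fun a => ?_
  have hma : Measurable fun p : ℝ × ℝ => κ a (p.1 - p.2) *
      (g₁ p.1 * g₂ (p.1 + a) * (g₃ p.2 * g₄ (p.2 + a))) := hm.comp measurable_prodMk_left
  exact (lintegral_prod _ hma.aemeasurable).symm

/-- Case distinction on which of ξ + a, η, η + a lie beyond t, given |ξ| ≥ 3t. None is impossible.
If exactly one does, then ξ + a or η lies within t, so |a| or |ξ - η| exceeds 2t and the kernel
gains t^(-1/2). If at least two do, two tail factors appear and no gain is needed. -/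
theorem decayForm_integrand_le {t : ℝ} (ht : 0 < t) (g : ℝ → ℝ≥0∞) (a ξ η : ℝ) :
    ENNReal.ofReal (decayKernel (a * (ξ - η))) *
        (outer (3 * t) g ξ * g (ξ + a) * (g η * g (η + a))) ≤
      ENNReal.ofReal (t ^ (-1 / 2 : ℝ)) * (ENNReal.ofReal (homogeneousKernel a (ξ - η)) *
          (outer (3 * t) g ξ * outer t g (ξ + a) * (g η * g (η + a))) +
        (ENNReal.ofReal (homogeneousKernel a (ξ - η)) *
          (outer (3 * t) g ξ * g (ξ + a) * (outer t g η * g (η + a))) +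
        ENNReal.ofReal (homogeneousKernel a (ξ - η)) *
          (outer (3 * t) g ξ * g (ξ + a) * (g η * outer t g (η + a))))) +
      (ENNReal.ofReal (homogeneousKernel a (ξ - η)) *
          (outer (3 * t) g ξ * outer t g (ξ + a) * (outer t g η * g (η + a))) +
        (ENNReal.ofReal (homogeneousKernel a (ξ - η)) *
          (outer (3 * t) g ξ * outer t g (ξ + a) * (g η * outer t g (η + a))) +
        ENNReal.ofReal (homogeneousKernel a (ξ - η)) *
          (outer (3 * t) g ξ * g (ξ + a) * (outer t g η * outer t g (η + a))))) := by
  set D := ENNReal.ofReal (decayKernel (a * (ξ - η))) with hD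
  set k := ENNReal.ofReal (homogeneousKernel a (ξ - η)) with hk
  set e := ENNReal.ofReal (t ^ (-1 / 2 : ℝ)) with he
  rcases lt_or_ge |ξ| (3 * t) with h1 | h1
  · rw [outer_of_lt h1]
    simp
  have hDk : D ≤ k := ENNReal.ofReal_le_ofReal (decayKernel_le_homogeneousKernel _ _)
  have hDe : t ≤ |a| + |ξ - η| → D ≤ e * k := fun h => by
    rw [he, hk, ← ENNReal.ofReal_mul (by positivity)]
    exact ENNReal.ofReal_le_ofReal (decayKernel_le_mul_homogeneousKernel ht h)
  have ha : |ξ| - |ξ + a| ≤ |a| := by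
    have := abs_sub_abs_le_abs_sub ξ (ξ + a)
    rwa [sub_add_cancel_left, abs_neg] at this
  have hb : |ξ| - |η| ≤ |ξ - η| := abs_sub_abs_le_abs_sub ξ η
  have hsum : |ξ| ≤ |ξ + a| + |η| + |η + a| := by
    calc |ξ| = |(ξ + a) + η + -(η + a)| := by ring_nf
      _ ≤ |ξ + a| + |η| + |-(η + a)| := abs_add_three _ _ _
      _ = _ := by rw [abs_neg]
  have hA := abs_nonneg a
  have hB := abs_nonneg (ξ - η)
  set P := outer (3 * t) g ξ
  rcases lt_or_ge |ξ + a| t with h2 | h2 <;> rcases lt_or_ge |η| t with h3 | h3 <;>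
    rcases lt_or_ge |η + a| t with h4 | h4
  · exfalso
    linarith
  · rw [outer_of_le h4, outer_of_lt h2, outer_of_lt h3]
    have := mul_le_mul_left (hDe (by linarith)) (P * g (ξ + a) * (g η * g (η + a)))
    refine this.trans (le_of_eq ?_)
    ring
  · rw [outer_of_le h3, outer_of_lt h2, outer_of_lt h4]
    have := mul_le_mul_left (hDe (by linarith)) (P * g (ξ + a) * (g η * g (η + a)))
    refine this.trans (le_of_eq ?_)
    ring
  · rw [outer_of_le h3, outer_of_le h4]
    refine le_add_left (le_add_left (le_add_left ?_))
    exact mul_le_mul_left hDk _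
  · rw [outer_of_le h2, outer_of_lt h3, outer_of_lt h4]
    have := mul_le_mul_left (hDe (by linarith)) (P * g (ξ + a) * (g η * g (η + a)))
    refine this.trans (le_of_eq ?_)
    ring
  · rw [outer_of_le h2, outer_of_le h4]
    refine le_add_left (le_add_left (le_add_right ?_))
    exact mul_le_mul_left hDk _
  · rw [outer_of_le h2, outer_of_le h3]
    refine le_add_left (le_add_right ?_)
    exact mul_le_mul_left hDk _
  · rw [outer_of_le h2, outer_of_le h3]
    refine le_add_left (le_add_right ?_)
    exact mul_le_mul_left hDk _

theorem decayForm_outer_le {t : ℝ} (ht : 0 < t) {g : ℝ → ℝ≥0∞} (hg : Measurable g) :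
    decayForm (outer (3 * t) g) g g g ≤
      resonantConst * lnorm (outer (3 * t) g) * lnorm (outer t g) *
        (3 * (ENNReal.ofReal (t ^ (-1 / 2 : ℝ)) * lnorm g ^ 2 + lnorm (outer t g) * lnorm g)) := by
  have hk : Measurable (Function.uncurry fun a b => ENNReal.ofReal (homogeneousKernel a b)) :=
    measurable_homogeneousKernel.ennreal_ofReal
  have hk' : Measurable fun q : ℝ × (ℝ × ℝ) =>
      ENNReal.ofReal (homogeneousKernel q.1 (q.2.1 - q.2.2)) :=
    hk.comp (f := fun q : ℝ × (ℝ × ℝ) => (q.1, q.2.1 - q.2.2)) (by fun_prop)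
  have hd : Measurable (Function.uncurry fun a b => ENNReal.ofReal (decayKernel (a * b))) :=
    (measurable_decayKernel.comp (measurable_fst.mul measurable_snd)).ennreal_ofReal
  have hP := measurable_outer hg (3 * t)
  have hH := measurable_outer hg t
  have key : decayForm (outer (3 * t) g) g g g ≤ ENNReal.ofReal (t ^ (-1 / 2 : ℝ)) *
      (resonantForm (fun a b => ENNReal.ofReal (homogeneousKernel a b))
          (outer (3 * t) g) (outer t g) g g +
        (resonantForm (fun a b => ENNReal.ofReal (homogeneousKernel a b))
          (outer (3 * t) g) g (outer t g) g +
        resonantForm (fun a b => ENNReal.ofReal (homogeneousKernel a b))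
          (outer (3 * t) g) g g (outer t g))) +
      (resonantForm (fun a b => ENNReal.ofReal (homogeneousKernel a b))
          (outer (3 * t) g) (outer t g) (outer t g) g +
        (resonantForm (fun a b => ENNReal.ofReal (homogeneousKernel a b))
          (outer (3 * t) g) (outer t g) g (outer t g) +
        resonantForm (fun a b => ENNReal.ofReal (homogeneousKernel a b))
          (outer (3 * t) g) g (outer t g) (outer t g))) := by
    unfold decayForm
    rw [resonantForm_eq_lintegral hd hP hg hg hg, resonantForm_eq_lintegral hk hP hH hg hg,
      resonantForm_eq_lintegral hk hP hg hH hg, resonantForm_eq_lintegral hk hP hg hg hH,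
      resonantForm_eq_lintegral hk hP hH hH hg, resonantForm_eq_lintegral hk hP hH hg hH,
      resonantForm_eq_lintegral hk hP hg hH hH,
      ← lintegral_add_left (by fun_prop), ← lintegral_add_left (by fun_prop),
      ← lintegral_const_mul _ (by fun_prop), ← lintegral_add_left (by fun_prop),
      ← lintegral_add_left (by fun_prop), ← lintegral_add_left (by fun_prop)]
    exact lintegral_mono fun q => decayForm_integrand_le ht g q.1 q.2.1 q.2.2
  refine key.trans ?_
  refine (add_le_add (mul_le_mul_right (add_le_add
    (resonantForm_homogeneousKernel_le hP hH hg hg) (add_le_add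
    (resonantForm_homogeneousKernel_le hP hg hH hg)
    (resonantForm_homogeneousKernel_le hP hg hg hH))) _) (add_le_add
    (resonantForm_homogeneousKernel_le hP hH hH hg) (add_le_add
    (resonantForm_homogeneousKernel_le hP hH hg hH)
    (resonantForm_homogeneousKernel_le hP hg hH hH)))).trans (le_of_eq ?_)
  ring

theorem lnorm_sq (g : ℝ → ℝ≥0∞) : lnorm g ^ 2 = ∫⁻ x, g x ^ 2 := by
  rw [lnorm, ← ENNReal.rpow_natCast, ← ENNReal.rpow_mul]
  norm_num

theorem lnorm_outer_le (s : ℝ) (g : ℝ → ℝ≥0∞) : lnorm (outer s g) ≤ lnorm g := by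
  unfold lnorm
  gcongr with x
  exact outer_le s g x

theorem tendsto_lnorm_outer {g : ℝ → ℝ≥0∞} (hg : Measurable g) (hfin : lnorm g ≠ ∞) :
    Filter.Tendsto (fun s => lnorm (outer s g)) Filter.atTop (nhds 0) := by
  have h2 : ∫⁻ x, g x ^ 2 ≠ ∞ := by
    rw [← lnorm_sq]
    exact ENNReal.pow_ne_top hfin
  have h := tendsto_lintegral_filter_of_dominated_convergence (μ := volume) (l := Filter.atTop)
    (F := fun s x => outer s g x ^ 2) (f := fun _ => 0) (fun x => g x ^ 2)
    (Filter.Eventually.of_forall fun s => (measurable_outer hg s).pow_const 2)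
    (Filter.Eventually.of_forall fun s => Filter.Eventually.of_forall fun x => by
      gcongr
      exact outer_le s g x) h2
    (Filter.Eventually.of_forall fun x => by
      refine tendsto_const_nhds.congr' ?_
      filter_upwards [Filter.eventually_gt_atTop |x|] with s hs
      rw [outer_of_lt hs]
      simp)
  have h3 := ((ENNReal.continuous_rpow_const (y := (1 / 2 : ℝ))).tendsto _).comp h
  simpa [lnorm, Function.comp_def] using h3

/-- One power of the tail beyond 3t cancels between the hypothesis and `decayForm_outer_le`; the
factor left in front of the tail beyond t tends to 0. -/
theorem eventually_lnorm_outer_le {g : ℝ → ℝ≥0∞} (hg : Measurable g) (hfin : lnorm g ≠ ∞)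
    {c C : ℝ≥0∞} (hc : c ≠ 0) (hc' : c ≠ ∞) (hC : C ≠ ∞)
    (h : ∀ s, 0 < s → c * lnorm (outer s g) ^ 2 ≤ C * decayForm (outer s g) g g g)
    {δ : ℝ≥0∞} (hδ : δ ≠ 0) :
    ∀ᶠ t : ℝ in Filter.atTop, lnorm (outer (3 * t) g) ≤ δ * lnorm (outer t g) := by
  have hM : c⁻¹ * C * resonantConst * 3 ≠ ∞ :=
    ENNReal.mul_ne_top (ENNReal.mul_ne_top (ENNReal.mul_ne_top (ENNReal.inv_ne_top.2 hc) hC)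
      resonantConst_lt_top.ne) (by norm_num)
  have he : Filter.Tendsto (fun t : ℝ => ENNReal.ofReal (t ^ (-1 / 2 : ℝ))) Filter.atTop
      (nhds 0) := by
    have h1 := tendsto_rpow_neg_atTop (y := (1 / 2 : ℝ)) (by norm_num)
    rw [← ENNReal.ofReal_zero]
    refine ENNReal.tendsto_ofReal (h1.congr fun t => ?_)
    norm_num
  have hlim : Filter.Tendsto (fun t : ℝ => c⁻¹ * C * resonantConst * 3 *
      (ENNReal.ofReal (t ^ (-1 / 2 : ℝ)) * lnorm g ^ 2 + lnorm (outer t g) * lnorm g))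
      Filter.atTop (nhds 0) := by
    have h1 := ENNReal.Tendsto.mul_const he (b := lnorm g ^ 2) (Or.inr (ENNReal.pow_ne_top hfin))
    have h2 := ENNReal.Tendsto.mul_const (tendsto_lnorm_outer hg hfin) (b := lnorm g)
      (Or.inr hfin)
    have h3 := ENNReal.Tendsto.const_mul (h1.add h2) (a := c⁻¹ * C * resonantConst * 3)
      (Or.inr hM)
    simpa using h3
  filter_upwards [hlim.eventually_le_const (pos_iff_ne_zero.2 hδ), Filter.eventually_gt_atTop 0]
    with t ht ht0
  set A := lnorm (outer (3 * t) g) with hA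
  -- Cancelling A requires A ≠ 0; a vanishing tail satisfies the claim trivially.
  by_cases hA0 : A = 0
  · rw [hA0]
    exact zero_le
  have hAtop : A ≠ ∞ := ne_top_of_le_ne_top hfin (lnorm_outer_le _ _)
  have h1 := (h (3 * t) (by positivity)).trans (mul_le_mul_right (decayForm_outer_le ht0 hg) C)
  rw [← hA] at h1
  calc A = A⁻¹ * (c⁻¹ * (c * A ^ 2)) := by
        rw [← mul_assoc c⁻¹, ENNReal.inv_mul_cancel hc hc', one_mul, sq, ← mul_assoc,
          ENNReal.inv_mul_cancel hA0 hAtop, one_mul]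
    _ ≤ A⁻¹ * (c⁻¹ * _) := mul_le_mul_right (mul_le_mul_right h1 _) _
    _ = (A⁻¹ * A) * (c⁻¹ * C * resonantConst * 3 * (ENNReal.ofReal (t ^ (-1 / 2 : ℝ)) *
        lnorm g ^ 2 + lnorm (outer t g) * lnorm g)) * lnorm (outer t g) := by ring
    _ ≤ δ * lnorm (outer t g) := by
        rw [ENNReal.inv_mul_cancel hA0 hAtop, one_mul]
        exact mul_le_mul_left ht _

/-- If |x| ≥ t, then 3^n t ≤ |x| < 3^(n+1) t for some n, and the n-th term alone suffices. -/
theorem enorm_pow_le_tsum {t : ℝ} (ht : 0 < t) (m : ℕ) (x : ℝ) :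
    ‖x‖ₑ ^ m ≤ ENNReal.ofReal t ^ m + ∑' n : ℕ, {x : ℝ | 3 ^ n * t ≤ |x|}.indicator
      (fun _ => (3 ^ (n + 1) * ENNReal.ofReal t) ^ m) x := by
  rcases lt_or_ge |x| t with h | h
  · refine le_add_right ?_
    gcongr
    rw [Real.enorm_eq_ofReal_abs]
    exact ENNReal.ofReal_le_ofReal h.le
  · refine le_add_left ?_
    obtain ⟨n, h1, h2⟩ := exists_nat_pow_near (x := |x| / t) (y := 3)
      ((one_le_div ht).2 h) (by norm_num)
    refine le_trans ?_ (ENNReal.le_tsum n)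
    rw [Set.indicator_of_mem (s := {x : ℝ | 3 ^ n * t ≤ |x|}) ((le_div_iff₀ ht).1 h1)]
    gcongr
    rw [Real.enorm_eq_ofReal_abs]
    refine (ENNReal.ofReal_le_ofReal ((div_lt_iff₀ ht).1 h2).le).trans (le_of_eq ?_)
    rw [ENNReal.ofReal_mul (by positivity), ENNReal.ofReal_pow (by norm_num)]
    norm_num

/-- If the tails of `g` shrink by arbitrarily small factors from scale to scale, all moments of
`g ^ 2` are finite. -/
theorem lintegral_enorm_pow_mul_sq_lt_top {g : ℝ → ℝ≥0∞} (hg : Measurable g) (hfin : lnorm g ≠ ∞)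
    (h : ∀ δ : ℝ≥0∞, δ ≠ 0 → ∀ᶠ t : ℝ in Filter.atTop,
      lnorm (outer (3 * t) g) ≤ δ * lnorm (outer t g)) (m : ℕ) :
    ∫⁻ x, ‖x‖ₑ ^ m * g x ^ 2 < ∞ := by
  have h3 : (3 : ℝ≥0∞) ^ m * 2 ≠ ∞ := ENNReal.mul_ne_top (by simp) (by norm_num)
  have h31 : (1 : ℝ≥0∞) ≤ 3 ^ m * 2 := one_le_mul (one_le_pow₀ (by norm_num)) (by norm_num)
  -- Passing from 3^n t to 3^(n+1) t multiplies the weight by 3^m and the squared tail by δ² ≤ δ, so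
  -- this δ makes the series geometric with ratio 1/2.
  set δ : ℝ≥0∞ := (3 ^ m * 2)⁻¹ with hδ
  have hδ1 : δ ≤ 1 := ENNReal.inv_le_one.2 h31
  obtain ⟨t₀, ht₀⟩ := Filter.eventually_atTop.1 (h δ (ENNReal.inv_ne_zero.2 h3))
  set t := max t₀ 1 with ht
  have ht1 : 0 < t := lt_of_lt_of_le one_pos (le_max_right _ _)
  have htail : ∀ n : ℕ, lnorm (outer (3 ^ n * t) g) ^ 2 ≤ δ ^ n * lnorm g ^ 2 := by
    intro n
    induction n with
    | zero =>
      rw [pow_zero, pow_zero, one_mul, one_mul]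
      gcongr
      exact lnorm_outer_le _ _
    | succ n ih =>
      have h4 : t₀ ≤ 3 ^ n * t :=
        (le_max_left t₀ 1).trans (le_mul_of_one_le_left ht1.le (one_le_pow₀ (by norm_num)))
      have h5 := ht₀ _ h4
      rw [← mul_assoc, ← pow_succ'] at h5
      calc lnorm (outer (3 ^ (n + 1) * t) g) ^ 2
          ≤ (δ * lnorm (outer (3 ^ n * t) g)) ^ 2 := by gcongr
        _ = δ * (δ * lnorm (outer (3 ^ n * t) g) ^ 2) := by ring
        _ ≤ δ * (1 * (δ ^ n * lnorm g ^ 2)) := by gcongr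
        _ = _ := by ring
  have hset : ∀ n : ℕ, MeasurableSet {x : ℝ | 3 ^ n * t ≤ |x|} := fun n => measurableSet_outer _
  set T := ENNReal.ofReal t with hT
  calc ∫⁻ x, ‖x‖ₑ ^ m * g x ^ 2
      ≤ ∫⁻ x, (T ^ m * g x ^ 2 + ∑' n : ℕ, (3 ^ (n + 1) * T) ^ m * outer (3 ^ n * t) g x ^ 2) := by
        refine lintegral_mono fun x => ?_
        refine (mul_le_mul_left (enorm_pow_le_tsum ht1 m x) _).trans (le_of_eq ?_)
        rw [add_mul, ← ENNReal.tsum_mul_right]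
        congr 2
        ext n
        by_cases hx : 3 ^ n * t ≤ |x|
        · rw [outer_of_le hx, Set.indicator_of_mem (s := {x : ℝ | 3 ^ n * t ≤ |x|}) hx]
        · rw [outer_of_lt (not_le.1 hx),
            Set.indicator_of_notMem (s := {x : ℝ | 3 ^ n * t ≤ |x|}) hx]
          simp
    _ = T ^ m * lnorm g ^ 2 + ∑' n : ℕ, (3 ^ (n + 1) * T) ^ m * lnorm (outer (3 ^ n * t) g) ^ 2 := by
        rw [lintegral_add_left (by fun_prop), lintegral_const_mul _ (by fun_prop), ← lnorm_sq,
          lintegral_tsum fun n => (((measurable_outer hg _).pow_const 2).const_mul _).aemeasurable]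
        congr 2
        ext n
        rw [lintegral_const_mul _ ((measurable_outer hg _).pow_const 2), ← lnorm_sq]
    _ ≤ T ^ m * lnorm g ^ 2 + ∑' n : ℕ, (3 * T) ^ m * lnorm g ^ 2 * (1 / 2) ^ n := by
        refine add_le_add le_rfl (ENNReal.tsum_le_tsum fun n => ?_)
        calc (3 ^ (n + 1) * T) ^ m * lnorm (outer (3 ^ n * t) g) ^ 2
            ≤ (3 ^ (n + 1) * T) ^ m * (δ ^ n * lnorm g ^ 2) := by
              gcongr
              exact htail n
          _ = (3 * T) ^ m * lnorm g ^ 2 * (3 ^ m * δ) ^ n := by ring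
          _ = _ := by
              have h6 : (3 : ℝ≥0∞) ^ m * δ = 1 / 2 := by
                rw [hδ, ENNReal.mul_inv (Or.inr (by norm_num)) (Or.inr (by norm_num)), ← mul_assoc,
                  ENNReal.mul_inv_cancel (by positivity) (by simp), one_mul, one_div]
              rw [h6]
    _ < ∞ := by
        have hN : lnorm g ^ 2 < ∞ := ENNReal.pow_lt_top hfin.lt_top
        rw [ENNReal.tsum_mul_left, ENNReal.tsum_geometric]
        refine ENNReal.add_lt_top.2 ⟨ENNReal.mul_lt_top (ENNReal.pow_lt_top (by simp [hT])) hN,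
          ENNReal.mul_lt_top (ENNReal.mul_lt_top (ENNReal.pow_lt_top
            (ENNReal.mul_lt_top (by norm_num) (by simp [hT]))) hN) ?_⟩
        norm_num

/-! ### Moments of a weak solution and of its Fourier transform -/

theorem lnorm_congr {g g' : ℝ → ℝ≥0∞} (h : g =ᵐ[volume] g') : lnorm g = lnorm g' := by
  unfold lnorm
  congr 1
  refine lintegral_congr_ae ?_
  filter_upwards [h] with x hx
  rw [hx]

theorem decayForm_congr_left {g₁ g₁' : ℝ → ℝ≥0∞} (h : g₁ =ᵐ[volume] g₁') (g₂ g₃ g₄ : ℝ → ℝ≥0∞) :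
    decayForm g₁ g₂ g₃ g₄ = decayForm g₁' g₂ g₃ g₄ := by
  refine lintegral_congr fun a => lintegral_congr_ae ?_
  filter_upwards [h] with ξ hξ
  rw [hξ]

theorem enorm_indicator_outer (s : ℝ) (F : ℝ → ℂ) (x : ℝ) :
    ‖{x : ℝ | s ≤ |x|}.indicator F x‖ₑ = outer s (fun x => ‖F x‖ₑ) x :=
  enorm_indicator_eq_indicator_enorm F x

/-- The restriction of an `L²` function to the complement of `(-s, s)`. -/
def outerPart (s : ℝ) (F : L2) : L2 :=
  ((Lp.memLp F).indicator (measurableSet_outer s)).toLp _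

theorem outerPart_ae_eq (s : ℝ) (F : L2) :
    outerPart s F =ᵐ[volume] {x : ℝ | s ≤ |x|}.indicator F :=
  MemLp.coeFn_toLp _

theorem enorm_outerPart_ae_eq (s : ℝ) (F : L2) :
    (fun x => ‖outerPart s F x‖ₑ) =ᵐ[volume] outer s fun x => ‖F x‖ₑ := by
  filter_upwards [outerPart_ae_eq s F] with x hx
  rw [hx, enorm_indicator_outer]

theorem enorm_inner_outerPart (s : ℝ) (F : L2) :
    ‖(inner ℂ (outerPart s F) F : ℂ)‖ₑ = lnorm (outer s fun x => ‖F x‖ₑ) ^ 2 := by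
  have h : (inner ℂ (outerPart s F) F : ℂ) = inner ℂ (outerPart s F) (outerPart s F) := by
    rw [L2.inner_eq_integral, L2.inner_eq_integral]
    refine integral_congr_ae ?_
    filter_upwards [outerPart_ae_eq s F] with x hx
    rw [hx]
    by_cases hs : x ∈ {x : ℝ | s ≤ |x|}
    · rw [Set.indicator_of_mem hs]
    · rw [Set.indicator_of_notMem hs]
      simp
  rw [h, inner_self_eq_norm_sq_to_K, enorm_pow, ← lnorm_congr (enorm_outerPart_ae_eq s F),
    lnorm_enorm]
  congr 1
  rw [← ofReal_norm, ← ofReal_norm]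
  simp

theorem IsWeakSolution.enorm_le {ω : ℝ} (hω : 0 < ω) {f : L2} (hf : IsWeakSolution ω f) (g : L2) :
    ENNReal.ofReal ω * ‖(inner ℂ g f : ℂ)‖ₑ = ‖dispersionFunctional g f f f‖ₑ := by
  rw [← hf g, enorm_mul]
  congr 1
  rw [← ofReal_norm, Complex.norm_real, Real.norm_of_nonneg hω.le]

/-- The equation is tested against the outer part of f itself. -/
theorem IsWeakSolution.position_tail {ω : ℝ} (hω : 0 < ω) {f : L2} (hf : IsWeakSolution ω f)
    (s : ℝ) :
    ENNReal.ofReal ω * lnorm (outer s fun x => ‖f x‖ₑ) ^ 2 ≤ ENNReal.ofReal 6 *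
      decayForm (outer s fun x => ‖f x‖ₑ) (fun x => ‖f x‖ₑ) (fun x => ‖f x‖ₑ)
        (fun x => ‖f x‖ₑ) := by
  rw [← enorm_inner_outerPart, hf.enorm_le hω, ← decayForm_congr_left (enorm_outerPart_ae_eq s f)]
  exact enorm_dispersionFunctional_le_position _ _ _ _

/-- The test function is the inverse transform of the outer part of the Fourier transform of f;
Plancherel moves the inner product to the frequency side. -/
theorem IsWeakSolution.frequency_tail {ω : ℝ} (hω : 0 < ω) {f : L2} (hf : IsWeakSolution ω f)
    (s : ℝ) :
    ENNReal.ofReal ω * lnorm (outer s fun x => ‖(𝓕 f : L2) x‖ₑ) ^ 2 ≤ ENNReal.ofReal 6 *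
      decayForm (outer s fun x => ‖(𝓕 f : L2) x‖ₑ) (fun x => ‖(𝓕 f : L2) x‖ₑ)
        (fun x => ‖(𝓕 f : L2) x‖ₑ) (fun x => ‖(𝓕 f : L2) x‖ₑ) := by
  have h1 : (inner ℂ (outerPart s (𝓕 f)) (𝓕 f) : ℂ) = inner ℂ (𝓕⁻ (outerPart s (𝓕 f)) : L2) f := by
    rw [← Lp.inner_fourier_eq (𝓕⁻ (outerPart s (𝓕 f)) : L2) f,
      FourierTransform.fourier_fourierInv_eq]
  rw [← enorm_inner_outerPart, h1, hf.enorm_le hω,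
    ← decayForm_congr_left (enorm_outerPart_ae_eq s (𝓕 f))]
  have h2 := enorm_dispersionFunctional_le_frequency (𝓕⁻ (outerPart s (𝓕 f)) : L2) f f f
  rwa [FourierTransform.fourier_fourierInv_eq] at h2

theorem moment_lt_top_of_tail {ω : ℝ} (hω : 0 < ω) (F : L2)
    (h : ∀ s, ENNReal.ofReal ω * lnorm (outer s fun x => ‖F x‖ₑ) ^ 2 ≤ ENNReal.ofReal 6 *
      decayForm (outer s fun x => ‖F x‖ₑ) (fun x => ‖F x‖ₑ) (fun x => ‖F x‖ₑ)
        (fun x => ‖F x‖ₑ)) (m : ℕ) :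
    ∫⁻ x, ‖x‖ₑ ^ m * ‖F x‖ₑ ^ 2 < ∞ := by
  have hm : Measurable fun x => ‖F x‖ₑ := (L2.measurable F).enorm
  have hfin : lnorm (fun x => ‖F x‖ₑ) ≠ ∞ := by
    rw [lnorm_enorm]
    exact enorm_ne_top
  exact lintegral_enorm_pow_mul_sq_lt_top hm hfin (fun δ hδ =>
    eventually_lnorm_outer_le hm hfin (by simpa using hω) ENNReal.ofReal_ne_top
      ENNReal.ofReal_ne_top (fun s _ => h s) hδ) m

/-- With A the integrand, 2A ≤ (1 + x²)⁻¹ + (1 + x²)A², and the last term is a sum of two moments,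
of orders 2n and 2n + 2. -/
theorem integrable_pow_mul_of_moments (F : L2)
    (h : ∀ m : ℕ, ∫⁻ x, ‖x‖ₑ ^ m * ‖F x‖ₑ ^ 2 < ∞) (n : ℕ) :
    Integrable fun x : ℝ => ‖x‖ ^ n * ‖F x‖ := by
  have hF : AEStronglyMeasurable (fun x => ‖F x‖) volume := (Lp.aestronglyMeasurable F).norm
  have hp : ∀ m : ℕ, AEStronglyMeasurable (fun x : ℝ => ‖x‖ ^ m) volume := fun m =>
    (continuous_norm.pow m).aestronglyMeasurable
  have hi : ∀ m : ℕ, Integrable fun x : ℝ => ‖x‖ ^ m * ‖F x‖ ^ 2 := by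
    intro m
    refine ⟨(hp m).mul (hF.pow 2), ?_⟩
    rw [HasFiniteIntegral]
    simpa [enorm_mul, enorm_pow] using h m
  refine (integrable_inv_one_add_sq.add ((hi (2 * n)).add (hi (2 * n + 2)))).mono'
    ((hp n).mul hF) (Filter.Eventually.of_forall fun x => ?_)
  rw [Real.norm_of_nonneg (by positivity)]
  simp only [Pi.add_apply]
  set A := ‖x‖ ^ n * ‖F x‖ with hA
  have h1 : ‖x‖ ^ (2 * n) * ‖F x‖ ^ 2 + ‖x‖ ^ (2 * n + 2) * ‖F x‖ ^ 2 = (1 + x ^ 2) * A ^ 2 := by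
    rw [hA, ← sq_abs x, ← Real.norm_eq_abs]
    ring
  rw [h1]
  have hw : 0 < 1 + x ^ 2 := by positivity
  have h2 : 0 ≤ ((1 + x ^ 2)⁻¹ - A) ^ 2 * (1 + x ^ 2) := by positivity
  have h3 : ((1 + x ^ 2)⁻¹ - A) ^ 2 * (1 + x ^ 2) =
      (1 + x ^ 2)⁻¹ - 2 * A + (1 + x ^ 2) * A ^ 2 := by
    field_simp
    ring
  have h4 : 0 ≤ A := by positivity
  linarith

/-! ### From finite moments to a Schwartz function -/

/-- Polynomially weighted supremum bounds of all orders. -/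
def RapidlyDecreasing (φ : ℝ → ℂ) : Prop :=
  ∀ m : ℕ, ∃ C : ℝ, ∀ x : ℝ, (1 + |x|) ^ m * ‖φ x‖ ≤ C

theorem one_add_abs_pow_le {x y : ℝ} (h : |y - x| ≤ 1) (m : ℕ) :
    (1 + |x|) ^ m ≤ 2 ^ m * (1 + |y|) ^ m := by
  rw [← mul_pow]
  have h1 : |x| ≤ |y| + |y - x| := by
    have := abs_sub_abs_le_abs_sub x y
    rw [abs_sub_comm] at this
    linarith
  have := abs_nonneg y
  gcongr
  linarith

/-- The optimal step is d = w^(-m): half of the weight w^(2m) is spent on making the error B d²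
harmless. -/
theorem le_div_of_forall_step {w N A B : ℝ} {m : ℕ} (hw : 1 ≤ w)
    (h : ∀ d : ℝ, 0 < d → d ≤ 1 → w ^ (2 * m) * (d * N) ≤ A + w ^ (2 * m) * (B * d ^ 2)) :
    w ^ m * N ≤ A + B := by
  have hw0 : 0 < w ^ m := by positivity
  have h1 := h ((w ^ m)⁻¹) (by positivity) (inv_le_one_of_one_le₀ (one_le_pow₀ hw))
  have h2 : w ^ (2 * m) = w ^ m * w ^ m := by ring
  rw [h2] at h1
  have h3 : w ^ m * w ^ m * ((w ^ m)⁻¹ * N) = w ^ m * N := by field_simp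
  have h4 : w ^ m * w ^ m * (B * (w ^ m)⁻¹ ^ 2) = B := by field_simp
  rwa [h3, h4] at h1

/-- A Lipschitz function stays within B d of φ(x) on [x, x + d], so integrating over this interval
controls d‖φ(x)‖ by the weighted L¹ norm plus an error B d². -/
theorem rapidlyDecreasing_of_integrable {φ : ℝ → ℂ} {B : ℝ} (hφ : Differentiable ℝ φ)
    (hB : ∀ x, ‖deriv φ x‖ ≤ B) (hi : ∀ n : ℕ, Integrable fun x : ℝ => (1 + |x|) ^ n * ‖φ x‖) :
    RapidlyDecreasing φ := by
  intro m
  refine ⟨2 ^ (2 * m) * (∫ x : ℝ, (1 + |x|) ^ (2 * m) * ‖φ x‖) + B, fun x => ?_⟩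
  have hB0 : 0 ≤ B := (norm_nonneg _).trans (hB 0)
  refine le_div_of_forall_step (by linarith [abs_nonneg x]) fun d hd hd1 => ?_
  have hlip : ∀ y, ‖φ x‖ ≤ ‖φ y‖ + B * |y - x| := fun y => by
    have h1 := Convex.norm_image_sub_le_of_norm_deriv_le (s := Set.univ) (x := y) (y := x)
      (fun z _ => hφ z) (fun z _ => hB z) convex_univ (Set.mem_univ _) (Set.mem_univ _)
    have h2 : ‖φ x‖ ≤ ‖φ y‖ + ‖φ x - φ y‖ := by
      simpa using norm_add_le (φ y) (φ x - φ y)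
    rw [Real.norm_eq_abs, abs_sub_comm] at h1
    linarith
  have hcφ : Continuous fun y => ‖φ y‖ := hφ.continuous.norm
  set W := (1 + |x|) ^ (2 * m) with hW
  have hW0 : 0 ≤ W := by positivity
  have hI : ∫ _ in x..(x + d), W * ‖φ x‖ ≤
      ∫ y in x..(x + d), (2 ^ (2 * m) * ((1 + |y|) ^ (2 * m) * ‖φ y‖) + W * (B * d)) := by
    refine intervalIntegral.integral_mono_on (by linarith) (by simp)
      (Continuous.intervalIntegrable (by fun_prop) _ _) fun y hy => ?_
    have hy1 : |y - x| ≤ d := by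
      rw [abs_of_nonneg (by linarith [hy.1])]
      linarith [hy.2]
    calc W * ‖φ x‖ ≤ W * (‖φ y‖ + B * d) := by
          gcongr
          exact (hlip y).trans (by gcongr)
      _ = W * ‖φ y‖ + W * (B * d) := by ring
      _ ≤ 2 ^ (2 * m) * (1 + |y|) ^ (2 * m) * ‖φ y‖ + W * (B * d) := by
          gcongr
          exact one_add_abs_pow_le (hy1.trans hd1) _
      _ = _ := by ring
  rw [intervalIntegral.integral_add (Continuous.intervalIntegrable (by fun_prop) _ _) (by simp),
    intervalIntegral.integral_const, intervalIntegral.integral_const,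
    intervalIntegral.integral_const_mul] at hI
  have hJ : ∫ y in x..(x + d), (1 + |y|) ^ (2 * m) * ‖φ y‖ ≤
      ∫ y : ℝ, (1 + |y|) ^ (2 * m) * ‖φ y‖ := by
    rw [intervalIntegral.integral_of_le (by linarith)]
    exact setIntegral_le_integral (hi _) (Filter.Eventually.of_forall fun y => by positivity)
  simp only [add_sub_cancel_left, smul_eq_mul] at hI
  calc W * (d * ‖φ x‖) = d * (W * ‖φ x‖) := by ring
    _ ≤ _ := hI
    _ ≤ 2 ^ (2 * m) * (∫ y : ℝ, (1 + |y|) ^ (2 * m) * ‖φ y‖) + d * (W * (B * d)) := by gcongr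
    _ = _ := by ring

/-- Interpolation between the decay of φ and the bound on its second derivative: d φ'(x) = φ(x + d)
- φ(x) + O(d²). -/
theorem RapidlyDecreasing.deriv {φ : ℝ → ℂ} {B : ℝ} (h : RapidlyDecreasing φ)
    (hφ : Differentiable ℝ φ) (hφ' : Differentiable ℝ (deriv φ))
    (hB : ∀ x, ‖deriv (deriv φ) x‖ ≤ B) : RapidlyDecreasing (deriv φ) := by
  intro m
  obtain ⟨C, hC⟩ := h (2 * m)
  refine ⟨2 ^ (2 * m) * C + C + B, fun x => ?_⟩
  have hB0 : 0 ≤ B := (norm_nonneg _).trans (hB 0)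
  refine le_div_of_forall_step (by linarith [abs_nonneg x]) fun d hd hd1 => ?_
  have hlip : ∀ y, ‖_root_.deriv φ y - _root_.deriv φ x‖ ≤ B * |y - x| := fun y =>
    Convex.norm_image_sub_le_of_norm_deriv_le (s := Set.univ) (x := x) (y := y)
      (fun z _ => hφ' z) (fun z _ => hB z) convex_univ (Set.mem_univ _) (Set.mem_univ _)
  -- Mean value inequality for y ↦ φ(y) - y φ'(x), whose derivative is at most B d on [x, x + d].
  have htaylor : ‖φ (x + d) - φ x - d * _root_.deriv φ x‖ ≤ B * d * d := by
    have hd' : ∀ y, HasDerivAt (fun y : ℝ => φ y - y * _root_.deriv φ x)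
        (_root_.deriv φ y - _root_.deriv φ x) y := fun y => by
      have h1 := ((hasDerivAt_id y).ofReal_comp).mul_const (_root_.deriv φ x)
      simpa using (hφ y).hasDerivAt.fun_sub h1
    have h2 := Convex.norm_image_sub_le_of_norm_hasDerivWithin_le (s := Set.Icc x (x + d))
      (x := x) (y := x + d) (C := B * d) (fun y _ => (hd' y).hasDerivWithinAt) (fun y hy => by
        refine (hlip y).trans ?_
        gcongr
        rw [abs_of_nonneg (by linarith [hy.1])]
        linarith [hy.2]) (convex_Icc _ _) ⟨le_rfl, by linarith⟩ ⟨by linarith, le_rfl⟩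
    rw [add_sub_cancel_left, Real.norm_of_nonneg hd.le] at h2
    refine le_trans (le_of_eq ?_) h2
    congr 1
    push_cast
    ring
  have hN : d * ‖_root_.deriv φ x‖ ≤ ‖φ (x + d)‖ + ‖φ x‖ + B * d ^ 2 := by
    have h3 : (d : ℂ) * _root_.deriv φ x =
        φ (x + d) - φ x - (φ (x + d) - φ x - d * _root_.deriv φ x) := by ring
    calc d * ‖_root_.deriv φ x‖ = ‖(d : ℂ) * _root_.deriv φ x‖ := by
          rw [norm_mul, Complex.norm_real, Real.norm_of_nonneg hd.le]
      _ ≤ ‖φ (x + d)‖ + ‖φ x‖ + B * d * d := by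
          rw [h3]
          exact (norm_sub_le _ _).trans (add_le_add (norm_sub_le _ _) htaylor)
      _ = _ := by ring
  have hw := one_add_abs_pow_le (x := x) (y := x + d)
    (by rwa [add_sub_cancel_left, abs_of_pos hd]) (2 * m)
  have h4 : (1 + |x|) ^ (2 * m) * ‖φ (x + d)‖ ≤ 2 ^ (2 * m) * C := by
    calc _ ≤ 2 ^ (2 * m) * (1 + |x + d|) ^ (2 * m) * ‖φ (x + d)‖ := by gcongr
      _ = 2 ^ (2 * m) * ((1 + |x + d|) ^ (2 * m) * ‖φ (x + d)‖) := by ring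
      _ ≤ _ := by
        gcongr
        exact hC _
  calc (1 + |x|) ^ (2 * m) * (d * ‖_root_.deriv φ x‖)
      ≤ (1 + |x|) ^ (2 * m) * (‖φ (x + d)‖ + ‖φ x‖ + B * d ^ 2) := by gcongr
    _ = (1 + |x|) ^ (2 * m) * ‖φ (x + d)‖ + (1 + |x|) ^ (2 * m) * ‖φ x‖ +
        (1 + |x|) ^ (2 * m) * (B * d ^ 2) := by ring
    _ ≤ _ := by
        gcongr
        exact hC x

theorem rapidlyDecreasing_iteratedDeriv {φ : ℝ → ℂ} (hs : ContDiff ℝ (⊤ : ℕ∞) φ)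
    (hB : ∀ n : ℕ, ∃ B : ℝ, ∀ x, ‖iteratedDeriv n φ x‖ ≤ B)
    (hi : ∀ n : ℕ, Integrable fun x : ℝ => (1 + |x|) ^ n * ‖φ x‖) (n : ℕ) :
    RapidlyDecreasing (iteratedDeriv n φ) := by
  have hd : ∀ n : ℕ, Differentiable ℝ (iteratedDeriv n φ) := fun n =>
    hs.differentiable_iteratedDeriv n (by exact_mod_cast WithTop.coe_lt_top n)
  induction n with
  | zero =>
    obtain ⟨B, hB⟩ := hB 1
    rw [iteratedDeriv_one] at hB
    rw [iteratedDeriv_zero]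
    have := hd 0
    rw [iteratedDeriv_zero] at this
    exact rapidlyDecreasing_of_integrable this hB hi
  | succ n ih =>
    obtain ⟨B, hB⟩ := hB (n + 2)
    have h1 := hd (n + 1)
    rw [iteratedDeriv_succ] at h1 ⊢
    refine ih.deriv (hd n) h1 (B := B) fun x => ?_
    rw [← iteratedDeriv_succ, ← iteratedDeriv_succ]
    exact hB x

/-- An `L²` function with integrable Fourier transform agrees with its inversion integral. -/
theorem ae_eq_fourier_reflect (f : L2) (hg : Integrable (𝓕 f : L2)) :
    f =ᵐ[volume] 𝓕 (fun ξ : ℝ => (𝓕 f : L2) (-ξ)) := by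
  have hk : Integrable fun ξ : ℝ => (𝓕 f : L2) (-ξ) := hg.comp_neg
  refine ae_eq_of_forall_schwartz (L2.locallyIntegrable _)
    (VectorFourier.fourierIntegral_continuous Real.continuous_fourierChar
      (L := innerₗ ℝ) continuous_inner hk).locallyIntegrable fun φ => ?_
  have h1 := integral_fourier_mul_eq (𝓕⁻ φ) f
  rw [FourierTransform.fourier_fourierInv_eq] at h1
  rw [h1, ← integral_schwartz_fourier_mul_eq φ hk, ← integral_neg_eq_self]
  congr 1 with ξ
  rw [SchwartzMap.fourierInv_coe, Real.fourierInv_eq_fourier_neg, neg_neg, SchwartzMap.fourier_coe]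

/-- An `L²` function all of whose moments are integrable, in position and in frequency, is almost
everywhere equal to a Schwartz function. -/
theorem exists_schwartz_ae_eq (f : L2) (hf : ∀ n : ℕ, Integrable fun x : ℝ => ‖x‖ ^ n * ‖f x‖)
    (hg : ∀ n : ℕ, Integrable fun ξ : ℝ => ‖ξ‖ ^ n * ‖(𝓕 f : L2) ξ‖) :
    ∃ φ : 𝓢(ℝ, ℂ), f =ᵐ[volume] φ := by
  -- The reflection turns Fourier inversion into a forward Fourier integral, to which the
  -- differentiation formulas apply.
  set k : ℝ → ℂ := fun ξ => (𝓕 f : L2) (-ξ) with hk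
  have hgm := Lp.aestronglyMeasurable (𝓕 f : L2)
  have hgi : Integrable (𝓕 f : L2) := by
    have h := hg 0
    simp only [pow_zero, one_mul] at h
    exact (integrable_norm_iff hgm).1 h
  have hki : Integrable k := hgi.comp_neg
  have hkn : ∀ n : ℕ, Integrable fun ξ : ℝ => ‖ξ‖ ^ n * ‖k ξ‖ := fun n => by
    simpa [hk] using (hg n).comp_neg
  have hks : ∀ n : ℕ, Integrable fun ξ : ℝ => ξ ^ n • k ξ := fun n => by
    have hm : AEStronglyMeasurable (fun ξ : ℝ => ξ ^ n • k ξ) volume :=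
      (continuous_pow n).aestronglyMeasurable.smul hki.aestronglyMeasurable
    refine (integrable_norm_iff hm).1 ?_
    simpa [norm_smul] using hkn n
  have hae := ae_eq_fourier_reflect f hgi
  have hs : ContDiff ℝ (⊤ : ℕ∞) (𝓕 k) := Real.contDiff_fourier fun n _ => hkn n
  have hB : ∀ n : ℕ, ∃ B : ℝ, ∀ x, ‖iteratedDeriv n (𝓕 k) x‖ ≤ B := fun n => by
    refine ⟨∫ v : ℝ, ‖(-2 * Real.pi * Complex.I * v) ^ n • k v‖, fun x => ?_⟩
    rw [Real.iteratedDeriv_fourier (N := ⊤) (fun n _ => hks n) le_top]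
    exact VectorFourier.norm_fourierIntegral_le_integral_norm _ _ _ _ _
  have hi : ∀ n : ℕ, Integrable fun x : ℝ => (1 + |x|) ^ n * ‖𝓕 k x‖ := fun n => by
    have h1 : Integrable fun x : ℝ => 2 ^ n * (‖x‖ ^ 0 * ‖f x‖ + ‖x‖ ^ n * ‖f x‖) :=
      ((hf 0).add (hf n)).const_mul _
    refine h1.mono' ?_ ?_
    · exact (Continuous.mul (by fun_prop) hs.continuous.norm).aestronglyMeasurable
    · filter_upwards [hae] with x hx
      rw [Real.norm_of_nonneg (by positivity), ← hx, ← add_mul, ← mul_assoc]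
      gcongr
      rw [pow_zero, Real.norm_eq_abs]
      rcases le_total |x| 1 with h | h
      · calc (1 + |x|) ^ n ≤ 2 ^ n := by
              gcongr
              linarith
          _ ≤ 2 ^ n * (1 + |x| ^ n) := le_mul_of_one_le_right (by positivity)
            (le_add_of_nonneg_right (by positivity))
      · calc (1 + |x|) ^ n ≤ (2 * |x|) ^ n := by
              gcongr
              linarith
          _ = 2 ^ n * |x| ^ n := mul_pow _ _ _
          _ ≤ _ := by
              gcongr
              exact le_add_of_nonneg_left zero_le_one
  refine ⟨⟨𝓕 k, hs, fun m n => ?_⟩, hae⟩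
  obtain ⟨C, hC⟩ := rapidlyDecreasing_iteratedDeriv hs hB hi n m
  refine ⟨C, fun x => le_trans ?_ (hC x)⟩
  rw [norm_iteratedFDeriv_eq_norm_iteratedDeriv, Real.norm_eq_abs]
  gcongr
  linarith

end

theorem theorem1 (ω : ℝ) (hω : 0 < ω) (f : L2) (hf : IsWeakSolution ω f) :
    ∃ φ : 𝓢(ℝ, ℂ), (∀ᵐ x : ℝ, f x = φ x) ∧ ContDiff ℝ (⊤ : ℕ∞) φ ∧
      ∀ m n : ℕ, BddAbove (Set.range fun x : ℝ => |x| ^ m * ‖iteratedDeriv n φ x‖) := by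
  obtain ⟨φ, hφ⟩ := exists_schwartz_ae_eq f
    (integrable_pow_mul_of_moments f (moment_lt_top_of_tail hω f fun s => hf.position_tail hω s))
    (integrable_pow_mul_of_moments (𝓕 f)
      (moment_lt_top_of_tail hω (𝓕 f) fun s => hf.frequency_tail hω s))
  refine ⟨φ, hφ, φ.smooth ⊤, fun m n => ?_⟩
  obtain ⟨C, hC⟩ := φ.decay' m n
  refine ⟨C, ?_⟩
  rintro _ ⟨x, rfl⟩
  have h := hC x
  rwa [norm_iteratedFDeriv_eq_norm_iteratedDeriv, Real.norm_eq_abs] at h
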